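/- Let $q$ be a prime power and let $t\ge 0$ be an integer, both fixed. Let $x\mapsto x^{\sigma}=x^q$ be the involution of $\mathbf F_{q^2}$ with fixed field $\mathbf F_q$, let $$\mathrm{GU}_n(q)=\{A\in \mathrm{GL}_n(\mathbf F_{q^2}) : A\,(A^{\sigma})^{T}=1\},$$ where $A^\sigma$ is $A$ with $\sigma$ applied to every entry, and let $\mathrm{SU}_n(q)$ be its subgroup of elements of determinant $1$. For a polynomial $\phi\in\mathbf F_{q^2}[z]$ with $\phi(0)\neq 0$ define its conjugate by $$\tilde\phi(z)=\phi(0)^{-\sigma}\,z^{\deg\phi}\,\phi^{\sigma}(1/z),$$ where $\phi^\sigma$ is $\phi$ with $\sigma$ applied to every coefficient. Let $\tilde N(q;j)$ be the number of monic irreducible $\phi\in\mathbf F_{q^2}[z]$ of degree $j$ with $\phi(0)\ne0$ and $\phi=\tilde\phi$, and let $\tilde M(q;j)$ be the number of unordered pairs $\{\phi,\tilde\phi\}$ of monic irreducible polynomials of degree $j$ over $\mathbf F_{q^2}$ with $\phi(0)\neq 0$ and $\phi\neq\tilde\phi$. Theorem. For every choice of cosets $C_n$ of $\mathrm{SU}_n(q)$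 in $\mathrm{GU}_n(q)$ (one for each $n$), the proportion of elements of $C_n$ whose characteristic polynomial has no irreducible factor over $\mathbf F_{q^2}$ of degree at most $t$ converges, as $n\to\infty$, to $$\prod_{j=1}^{t}\left(\prod_{i\ge1}\Bigl(1+\frac1{(-q)^{ij}}\Bigr)^{\tilde N(q;j)}\;\prod_{i\ge1}\Bigl(1-\frac1{q^{2ij}}\Bigr)^{\tilde M(q;j)}\right),$$ where all these infinite products converge (unconditionally). -/

import Mathlib

open Polynomial Filter Topology
open scoped Pointwise

noncomputable section

namespace UnitaryCoset

variable (F K : Type*) [Field F] [Fintype F] [Field K] [Algebra F K]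

/-- The map `x ↦ x ^ q` on `K`, where `q` is the cardinality of `F`.  When `K` is quadratic over `F`
this is the involution `σ` of `K = 𝔽_{q²}` with fixed field `F = 𝔽_q`. -/
abbrev conj : K →+* K := (FiniteField.frobeniusAlgHom F K : K →+* K)

theorem conj_apply (x : K) : conj F K x = x ^ Fintype.card F := rfl

/-- The general unitary group `GU_n(q)`: invertible matrices `A` over `K = 𝔽_{q²}` with
`A * (Aᵟ)ᵀ = 1`, where `Aᵟ` is obtained by raising each entry to the power `q`. -/
def GU (n : ℕ) : Subgroup (Matrix.GeneralLinearGroup (Fin n) K) where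
  carrier := {A | (A : Matrix (Fin n) (Fin n) K) *
    ((A : Matrix (Fin n) (Fin n) K).map (conj F K)).transpose = 1}
  one_mem' := by
    simp [Matrix.map_one]
  mul_mem' := by
    intro A B hA hB
    simp only [Set.mem_ofPred_eq] at hA hB ⊢
    rw [Units.val_mul, Matrix.map_mul, Matrix.transpose_mul, Matrix.mul_assoc,
      ← Matrix.mul_assoc (B : Matrix (Fin n) (Fin n) K), hB, Matrix.one_mul, hA]
  inv_mem' := by
    intro A hA
    simp only [Set.mem_ofPred_eq] at hA ⊢
    have h1 : ((A⁻¹ : Matrix.GeneralLinearGroup (Fin n) K) : Matrix (Fin n) (Fin n) K) =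
        ((A : Matrix (Fin n) (Fin n) K).map (conj F K)).transpose :=
      Units.inv_eq_of_mul_eq_one_right hA
    have h2 : (A : Matrix (Fin n) (Fin n) K) *
        ((A⁻¹ : Matrix.GeneralLinearGroup (Fin n) K) : Matrix (Fin n) (Fin n) K) = 1 :=
      Units.mul_inv A
    have h3 := congrArg (fun M => (M.map (conj F K)).transpose) h2
    simp only [Matrix.map_mul, Matrix.transpose_mul] at h3
    rw [← h1, Matrix.map_one _ (map_zero _) (map_one _), Matrix.transpose_one] at h3
    exact mul_eq_one_comm.mp h3

/-- The special unitary group `SU_n(q)`, as a subgroup of `GU_n(q)`: the kernel of `det`. -/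
def SU (n : ℕ) : Subgroup (GU F K n) :=
  ((Matrix.GeneralLinearGroup.det : Matrix.GeneralLinearGroup (Fin n) K →* Kˣ).comp
    (GU F K n).subtype).ker

/-- The conjugate `φ̃(z) = φ(0)^{-σ} z^{deg φ} φ^σ(1/z)` of a polynomial `φ` with `φ(0) ≠ 0`.
(It is only used for such `φ`.) -/
def tildeConj (φ : K[X]) : K[X] :=
  C (conj F K (φ.coeff 0))⁻¹ * (φ.map (conj F K)).reverse

/-- `Ñ(q;j)`: the number of monic irreducible polynomials `φ` of degree `j` over `𝔽_{q²}` with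
nonzero constant term and `φ = φ̃`. -/
def tildeN (j : ℕ) : ℕ :=
  Set.ncard {φ : K[X] | φ.Monic ∧ Irreducible φ ∧ φ.natDegree = j ∧ φ.coeff 0 ≠ 0 ∧
    φ = tildeConj F K φ}

/-- `M̃(q;j)`: the number of unordered pairs `{φ, φ̃}` of monic irreducible polynomials of degree
`j` over `𝔽_{q²}` with nonzero constant term and `φ ≠ φ̃`. -/
def tildeM (j : ℕ) : ℕ :=
  Set.ncard {p : Sym2 K[X] | ∃ φ : K[X], φ.Monic ∧ Irreducible φ ∧ φ.natDegree = j ∧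
    φ.coeff 0 ≠ 0 ∧ φ ≠ tildeConj F K φ ∧ p = s(φ, tildeConj F K φ)}

variable {K} in
/-- The characteristic polynomial of `A` has no irreducible factor of degree at most `t`. -/
def NoSmallFactor (t : ℕ) {n : ℕ} (A : Matrix (Fin n) (Fin n) K) : Prop :=
  ∀ φ : K[X], Irreducible φ → φ ∣ A.charpoly → t < φ.natDegree

variable {F K} in
/-- The proportion of elements of `S ⊆ GU_n(q)` whose characteristic polynomial has no irreducible
factor of degree at most `t`. -/
def proportion (t : ℕ) {n : ℕ} (S : Set (GU F K n)) : ℝ :=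
  (Set.ncard {A : GU F K n | A ∈ S ∧
    NoSmallFactor t ((A : Matrix.GeneralLinearGroup (Fin n) K) : Matrix (Fin n) (Fin n) K)} : ℝ) /
    (Set.ncard S : ℝ)

end UnitaryCoset

end

/-!
For multiplicities `k : φ ↦ k_φ` on the monic irreducible polynomials `φ ≠ z` of degree at most
`t`, let `T_k` be multiplication by `z` on `⨁ (K[z]/φ)^{k_φ}`. The number of injective linear maps
intertwining `T_k` with `A` is a product of Gaussian factors, one for each `φ`, and a `q`-analogue
of inclusion-exclusion writes the indicator of "`A` has no small factor" as a combination of these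
numbers whose coefficients do not depend on `A` or `n`.

An embedding equivariant for some unitary `A` pulls the standard Hermitian form back to a
`T_k`-invariant form. Conversely every form `β` on the source is such a pullback when `n` is large,
and by Witt's theorem the group permutes the embeddings inducing `β` transitively. Once `n` exceeds
twice the dimension of the source, an embedding misses a nondegenerate vector up to isometry, so
already `SU_n` is transitive. Hence in each coset the average number of equivariant embeddings
stabilizes at the number of `T_k`-invariant Hermitian forms, a power of `q` that depends only on
`k`. For all `n` the average is at most `|Kˣ|` times this, which permits dominated convergence.

The limiting series factors over the orbits of `φ ↦ φ̃` and is summed by Euler's identities. A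
self-conjugate `φ` has odd degree, which is why `-q` appears.
-/

noncomputable section

namespace UnitaryCoset

section Involution

variable {K : Type*} [Field K] {σ : K →+* K}

theorem exists_add_apply_eq_one (hσ : Function.Involutive σ) (hne : σ ≠ RingHom.id K) :
    ∃ x, x + σ x = 1 := by
  obtain ⟨x, hx⟩ : ∃ x, x + σ x ≠ 0 := by
    by_contra! h
    obtain ⟨x, hx : σ x ≠ x⟩ := DFunLike.ne_iff.1 hne
    have two_eq_zero : (1 : K) + 1 = 0 := by simpa using h 1
    exact hx (by linear_combination h x - x * two_eq_zero)
  refine ⟨x / (x + σ x), ?_⟩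
  rw [map_div₀, map_add, hσ x, add_comm (σ x) x, ← add_div, div_self hx]

theorem exists_ne_zero_add_apply_eq (hσ : Function.Involutive σ) (hne : σ ≠ RingHom.id K) {c : K}
    (hc : σ c = c) : ∃ x, x ≠ 0 ∧ x + σ x = c := by
  by_cases h0 : c = 0
  · obtain ⟨x, hx : σ x ≠ x⟩ := DFunLike.ne_iff.1 hne
    exact ⟨σ x - x, sub_ne_zero.2 hx, by rw [map_sub, hσ, h0]; ring⟩
  · obtain ⟨x, hx⟩ := exists_add_apply_eq_one hσ hne
    refine ⟨c * x, mul_ne_zero h0 ?_, ?_⟩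
    · rintro rfl
      simp at hx
    · rw [map_mul, hc, ← mul_add, hx, mul_one]

end Involution

section Frobenius

variable {F K : Type*} [Field F] [Field K] [Algebra F K]

theorem finite_of_finrank_eq_two [Finite F] (hK : Module.finrank F K = 2) : Finite K :=
  have : FiniteDimensional F K := FiniteDimensional.of_finrank_pos (by omega)
  Module.finite_of_finite F

variable [Fintype F]

theorem natCard_eq_sq (hK : Module.finrank F K = 2) : Nat.card K = Fintype.card F ^ 2 := by
  have := finite_of_finrank_eq_two hK
  rw [Module.natCard_eq_pow_finrank (K := F), hK, Nat.card_eq_fintype_card]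

theorem conj_involutive (hK : Module.finrank F K = 2) : Function.Involutive (conj F K) := by
  have := finite_of_finrank_eq_two hK
  have := Fintype.ofFinite K
  intro x
  rw [conj_apply, conj_apply, ← pow_mul, ← pow_two, ← natCard_eq_sq hK, Nat.card_eq_fintype_card,
    FiniteField.pow_card]

theorem conj_ne_id (hK : Module.finrank F K = 2) : conj F K ≠ RingHom.id K := by
  have := finite_of_finrank_eq_two hK
  have := Fintype.ofFinite K
  intro h
  have frobenius_eq_one : FiniteField.frobeniusAlgHom F K = 1 :=
    AlgHom.ext fun x => RingHom.congr_fun h x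
  have := FiniteField.orderOf_frobeniusAlgHom F K
  rw [frobenius_eq_one, orderOf_one, hK] at this
  omega

theorem exists_conj_mul_eq_neg_one (hK : Module.finrank F K = 2) :
    ∃ x : K, conj F K x * x = -1 := by
  have := finite_of_finrank_eq_two hK
  obtain ⟨x, hx⟩ := FiniteField.norm_surjective F K (-1)
  have := FiniteField.algebraMap_norm_eq_prod_pow F K x
  rw [hx, hK] at this
  exact ⟨x, by simpa [Finset.prod_range_succ, conj_apply, mul_comm] using this.symm⟩

end Frobenius

section Isometry

variable {K V : Type*} [Field K] {σ : K →+* K} [AddCommGroup V] [Module K V]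
  {h : V →ₛₗ[σ] V →ₗ[K] K}

/-- The isometry group of a sesquilinear form. -/
def isometryGroup (h : V →ₛₗ[σ] V →ₗ[K] K) : Subgroup (V ≃ₗ[K] V) where
  carrier := {e | ∀ x y, h (e x) (e y) = h x y}
  one_mem' _ _ := rfl
  mul_mem' he he' x y := (he _ _).trans (he' x y)
  inv_mem' {e} he x y := by
    rw [← he, ← LinearEquiv.mul_apply, ← LinearEquiv.mul_apply, mul_inv_cancel]
    rfl

theorem form_isometry_apply (e : isometryGroup h) (x y : V) :
    h (e.1 x) (e.1 y) = h x y := e.2 x y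

theorem injective_of_isometry (hr : h.SeparatingRight) {f : V →ₗ[K] V}
    (hf : ∀ x y, h (f x) (f y) = h x y) : Function.Injective f := by
  rw [← LinearMap.ker_eq_bot, LinearMap.ker_eq_bot']
  exact fun y hy => hr y fun x => by rw [← hf, hy, map_zero]

theorem exists_dual_ne_zero_ne_zero {H : Submodule K V} {x y : V} (hx : x ∉ H) (hy : y ∉ H) :
    ∃ f : Module.Dual K V, f x ≠ 0 ∧ f y ≠ 0 ∧ ∀ z ∈ H, f z = 0 := by
  obtain ⟨f, hfx, hf⟩ := Submodule.exists_le_ker_of_notMem hx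
  obtain ⟨g, hgy, hg⟩ := Submodule.exists_le_ker_of_notMem hy
  by_cases hfy : f y = 0
  · by_cases hgx : g x = 0
    · exact ⟨f + g, by simpa [hgx], by simpa [hfy], fun z hz => by
        rw [LinearMap.add_apply, hf hz, hg hz, add_zero]⟩
    · exact ⟨g, hgx, hgy, hg⟩
  · exact ⟨f, hfx, hfy, hf⟩

variable [FiniteDimensional K V]

theorem exists_isometryGroup_eq (hr : h.SeparatingRight) {f : V →ₗ[K] V}
    (hf : ∀ x y, h (f x) (f y) = h x y) : ∃ e : isometryGroup h, ∀ x, e.1 x = f x :=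
  ⟨⟨LinearEquiv.ofInjectiveEndo f (injective_of_isometry hr hf), hf⟩, fun _ => rfl⟩

theorem exists_quasiReflection (hh : h.IsSymm) (hr : h.SeparatingRight) {w : V} {a : K}
    (ha : a + σ a + a * σ a * h w w = 0) :
    ∃ e : isometryGroup h, ∀ x, e.1 x = x + (a * h w x) • w := by
  obtain ⟨e, he⟩ := exists_isometryGroup_eq hr
    (f := LinearMap.id + (a • h w).smulRight w) fun x y => by
      have hwx : σ (h w x) = h x w := hh.eq w x
      simp only [LinearMap.add_apply, LinearMap.id_apply, LinearMap.smulRight_apply,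
        LinearMap.smul_apply, smul_eq_mul, map_add, LinearMap.map_smulₛₗ, map_mul, hwx,
        RingHom.id_apply]
      linear_combination h x w * h w y * ha
  exact ⟨e, he⟩

theorem surjective_of_separatingLeft (hσ : Function.Involutive σ) (hl : h.SeparatingLeft) :
    Function.Surjective h := by
  have : RingHomInvPair σ σ := ⟨RingHom.ext hσ, RingHom.ext hσ⟩
  have : RingHomSurjective σ := ⟨hσ.surjective⟩
  let e := LinearEquiv.ofInjective h (LinearMap.ker_eq_bot.1
    (LinearMap.separatingLeft_iff_ker_eq_bot.1 hl))
  have finrank_range : Module.finrank K V = Module.finrank K (LinearMap.range h) := by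
    have := congrArg Cardinal.toNat
      (lift_rank_eq_of_equiv_equiv σ e.toAddEquiv hσ.bijective e.map_smulₛₗ)
    rwa [Cardinal.toNat_lift, Cardinal.toNat_lift] at this
  rw [← LinearMap.range_eq_top]
  exact Submodule.eq_top_of_finrank_eq (finrank_range.symm.trans Subspace.dual_finrank_eq.symm)

/-- The quasi-reflection along `x - y`. -/
theorem exists_isometry_apply_eq_of_ne (hh : h.IsSymm) (hr : h.SeparatingRight) {x y : V}
    (hxy : h x x = h y y) (hne : h y x ≠ h x x) :
    ∃ e : isometryGroup h, e.1 x = y ∧ ∀ v, h x v = h y v → e.1 v = v := by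
  have hc : h (x - y) x ≠ 0 := by
    rw [map_sub, LinearMap.sub_apply]
    exact sub_ne_zero.2 hne.symm
  have norm_sub : h (x - y) (x - y) = h (x - y) x + σ (h (x - y) x) := by
    rw [hh.eq]
    simp only [map_sub, LinearMap.sub_apply, hxy]
    ring
  obtain ⟨e, he⟩ := exists_quasiReflection hh hr (w := x - y) (a := -(h (x - y) x)⁻¹) (by
    have hc' : σ (h (x - y) x) ≠ 0 := (map_ne_zero σ).2 hc
    rw [norm_sub, map_neg, map_inv₀]
    field_simp
    ring)
  refine ⟨e, ?_, fun v hv => ?_⟩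
  · rw [he, neg_mul, inv_mul_cancel₀ hc, neg_one_smul, add_neg_eq_iff_eq_add]
    abel
  · have hwv : h (x - y) v = 0 := by rw [map_sub, LinearMap.sub_apply, hv, sub_self]
    rw [he, hwv, mul_zero, zero_smul, add_zero]

theorem exists_isometry_apply_eq_of_notMem (hσ : Function.Involutive σ) (hne : σ ≠ RingHom.id K)
    (hh : h.IsSymm) (hnd : h.Nondegenerate) {H : Submodule K V} {x y : V} (hx : x ∉ H)
    (hy : y ∉ H) (hxy : h x x = h y y) (hH : ∀ v ∈ H, h x v = h y v) :
    ∃ e : isometryGroup h, e.1 x = y ∧ ∀ v ∈ H, e.1 v = v := by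
  by_cases hyx : h y x = h x x
  swap
  · obtain ⟨e, hex, he⟩ := exists_isometry_apply_eq_of_ne hh hnd.2 hxy hyx
    exact ⟨e, hex, fun v hv => he v (hH v hv)⟩
  obtain ⟨f, hfx, hfy, hfH⟩ := exists_dual_ne_zero_ne_zero hx hy
  obtain ⟨w, rfl⟩ := surjective_of_separatingLeft hσ hnd.1 f
  obtain ⟨b, hb, hbw⟩ := exists_ne_zero_add_apply_eq hσ hne (c := -h w w) (by
    rw [map_neg, hh.eq])
  obtain ⟨r, hr⟩ := exists_quasiReflection hh hnd.2 (w := w) (a := b⁻¹) (by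
    have hσb : σ b ≠ 0 := (map_ne_zero σ).2 hb
    rw [map_inv₀]
    field_simp
    linear_combination hbw)
  have r_fix : ∀ v ∈ H, r.1 v = v := fun v hv => by rw [hr, hfH v hv]; simp
  obtain ⟨e, hex, he⟩ := exists_isometry_apply_eq_of_ne hh hnd.2 (x := x) (y := r.1 y)
    (by rw [form_isometry_apply, hxy]) (by
      rw [hr, map_add, LinearMap.add_apply, hyx, LinearMap.map_smulₛₗ, LinearMap.smul_apply,
        smul_eq_mul]
      simp [hb, hfx, hfy])
  refine ⟨r⁻¹ * e, ?_, fun v hv => ?_⟩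
  · change r.1⁻¹ (e.1 x) = y
    rw [hex]
    exact r.1.symm_apply_apply y
  · change r.1⁻¹ (e.1 v) = v
    rw [he v (by rw [hH v hv, ← form_isometry_apply r y v, r_fix v hv])]
    exact r.1.symm_apply_eq.2 (r_fix v hv).symm

/-- Witt's extension theorem. -/
theorem exists_isometry_comp_eq (hσ : Function.Involutive σ) (hne : σ ≠ RingHom.id K)
    (hh : h.IsSymm) (hnd : h.Nondegenerate) {M : Type*} [AddCommGroup M] [Module K M]
    {f g : M →ₗ[K] V} (hf : Function.Injective f) (hg : Function.Injective g)
    (hfg : ∀ x y, h (f x) (f y) = h (g x) (g y)) :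
    ∃ e : isometryGroup h, e.1.toLinearMap ∘ₗ f = g := by
  have : Module.Finite K M := Module.Finite.of_injective f hf
  suffices ∀ N : Submodule K M, ∃ e : isometryGroup h, ∀ x ∈ N, e.1 (f x) = g x by
    obtain ⟨e, he⟩ := this ⊤
    exact ⟨e, LinearMap.ext fun x => he x Submodule.mem_top⟩
  intro N
  induction N, IsNoetherian.noetherian N using Submodule.fg_sup_span_induction with
  | bot => exact ⟨1, fun x hx => by simp [(Submodule.mem_bot K).1 hx]⟩
  | sup N v _ ih =>
    obtain ⟨e, he⟩ := ih
    by_cases hv : v ∈ N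
    · rw [sup_eq_left.2 ((Submodule.span_singleton_le_iff_mem v N).2 hv)]
      exact ⟨e, he⟩
    have notMem : ∀ k : M →ₗ[K] V, Function.Injective k → (∀ x ∈ N, k x = g x) →
        k v ∉ N.map g := by
      rintro k hk hkg ⟨x, hx, hxv⟩
      rw [← hkg x hx] at hxv
      exact hv (hk hxv ▸ hx)
    obtain ⟨e', hev, he'⟩ := exists_isometry_apply_eq_of_notMem hσ hne hh hnd
      (notMem (e.1.toLinearMap ∘ₗ f) (e.1.injective.comp hf) he) (notMem g hg fun _ _ => rfl)
      ((form_isometry_apply e _ _).trans (hfg v v)) (by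
        rintro _ ⟨x, hx, rfl⟩
        rw [← hfg, ← he x hx]
        exact form_isometry_apply e _ _)
    refine ⟨e' * e, fun x hx => ?_⟩
    obtain ⟨y, hy, z, hz, rfl⟩ := Submodule.mem_sup.1 hx
    obtain ⟨c, rfl⟩ := Submodule.mem_span_singleton.1 hz
    change e'.1 (e.1 (f (y + c • v))) = g (y + c • v)
    have hev : e'.1 (e.1 (f v)) = g v := hev
    simp only [map_add, map_smul, hev, he y hy, he' _ (Submodule.mem_map_of_mem hy)]

end Isometry

section GroupCounting

variable {G X : Type*} [Group G] [MulAction G X]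

theorem natCard_setOf_smul_eq_mul_natCard [MulAction.IsPretransitive G X] (x y : X) :
    Nat.card {g : G // g • x = y} * Nat.card X = Nat.card G := by
  obtain ⟨a, rfl⟩ := MulAction.exists_smul_eq G x y
  have e : {g : G // g • x = a • x} ≃ MulAction.stabilizer G x :=
    (Equiv.mulLeft a⁻¹).subtypeEquiv fun g => by
      rw [MulAction.mem_stabilizer_iff, Equiv.coe_mulLeft, mul_smul, inv_smul_eq_iff]
  rw [Nat.card_congr e, ← MulAction.index_stabilizer_of_transitive G x, Subgroup.card_mul_index]

/-- Any map `S` replaces the identity in Burnside's count of fixed points. -/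
theorem natCard_setOf_smul_eq_apply [MulAction.IsPretransitive G X] [Finite G] [Finite X]
    [Nonempty X] (S : X → X) : Nat.card {p : G × X // p.1 • p.2 = S p.2} = Nat.card G := by
  have := Fintype.ofFinite X
  have e : {p : G × X // p.1 • p.2 = S p.2} ≃ Σ x, {g : G // g • x = S x} :=
    { toFun p := ⟨p.1.2, p.1.1, p.2⟩
      invFun p := ⟨(p.2.1, p.1), p.2.2⟩ }
  refine Nat.eq_of_mul_eq_mul_right (Nat.card_pos (α := X)) ?_
  rw [Nat.card_congr e, Nat.card_sigma, Finset.sum_mul]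
  simp only [natCard_setOf_smul_eq_mul_natCard, Finset.sum_const, Finset.card_univ, smul_eq_mul]
  rw [Nat.card_eq_fintype_card (α := X), mul_comm]

theorem sum_natCard_smul_eq [Finite X] [Nonempty X] {N : Type*} [Group N] [Fintype N]
    (ρ : N →* G) (hρ : ∀ x y : X, ∃ a, ρ a • x = y) (g : G) (S : X → X) :
    ∑ a, Nat.card {x : X // (g * ρ a) • x = S x} = Nat.card N := by
  let _ : MulAction N X := MulAction.compHom X ρ
  have : MulAction.IsPretransitive N X := ⟨hρ⟩
  rw [← Nat.card_sigma, ← natCard_setOf_smul_eq_apply (G := N) fun x => g⁻¹ • S x]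
  exact Nat.card_congr
    { toFun p := ⟨(p.1, p.2.1), eq_inv_smul_iff.2 ((mul_smul _ _ _).symm.trans p.2.2)⟩
      invFun p := ⟨p.1.1, p.1.2, (mul_smul _ _ _).trans (eq_inv_smul_iff.1 p.2)⟩ }

theorem isPretransitive_subgroup_of_stabilizer [MulAction.IsPretransitive G X] {N : Subgroup G}
    (x : X) (hN : ∀ g : G, ∃ s ∈ MulAction.stabilizer G x, g * s ∈ N) :
    MulAction.IsPretransitive N X := by
  refine MulAction.IsPretransitive.of_orbit (x₀ := x) fun y => ?_
  obtain ⟨g, rfl⟩ := MulAction.exists_smul_eq G x y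
  obtain ⟨s, hs, hgs⟩ := hN g
  exact ⟨⟨g * s, hgs⟩, by rw [Subgroup.mk_smul, mul_smul, hs]⟩

end GroupCounting

section Forms

variable {K M V : Type*} [Field K] {σ : K →+* K} [AddCommGroup M] [Module K M]
  [AddCommGroup V] [Module K V] {h : V →ₛₗ[σ] V →ₗ[K] K}

theorem finite_sesquilinear [Finite K] [Module.Finite K M] : Finite (M →ₛₗ[σ] M →ₗ[K] K) :=
  have : Finite M := Module.finite_of_finite K
  have : Finite (M →ₗ[K] K) := DFunLike.finite _
  DFunLike.finite _

/-- The pullback of a sesquilinear form along a linear map. -/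
def pullback (h : V →ₛₗ[σ] V →ₗ[K] K) (f : M →ₗ[K] V) : M →ₛₗ[σ] M →ₗ[K] K :=
  (h.comp f).compl₂ f

theorem pullback_apply (f : M →ₗ[K] V) (x y : M) : pullback h f x y = h (f x) (f y) := rfl

/-- The sesquilinear forms for which `T` is an isometry. -/
def invariantForms (σ : K →+* K) (T : Module.End K M) : Set (M →ₛₗ[σ] M →ₗ[K] K) :=
  {β | pullback β T = β}

/-- The Hermitian forms for which `T` is an isometry. -/
def invariantHermitianForms (σ : K →+* K) (T : Module.End K M) : Set (M →ₛₗ[σ] M →ₗ[K] K) :=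
  {β | β.IsSymm ∧ pullback β T = β}

/-- An isometric embedding of `(M, β)` into `(V, h)`. -/
@[ext]
structure IsometricEmb (β : M →ₛₗ[σ] M →ₗ[K] K) (h : V →ₛₗ[σ] V →ₗ[K] K) where
  toLinearMap : M →ₗ[K] V
  injective : Function.Injective toLinearMap
  pullback_eq : pullback h toLinearMap = β

/-- The embeddings of the `K[z]`-module `(M, T)` into `(V, A)`. -/
def equivariantEmb (T : Module.End K M) (A : Module.End K V) : Set (M →ₗ[K] V) :=
  {f | Function.Injective f ∧ f ∘ₗ T = A ∘ₗ f}

section Action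

variable {β : M →ₛₗ[σ] M →ₗ[K] K}

theorem IsometricEmb.apply_apply (f : IsometricEmb β h) (x y : M) :
    h (f.toLinearMap x) (f.toLinearMap y) = β x y :=
  LinearMap.congr_fun₂ f.pullback_eq x y

theorem finite_isometricEmb [Finite K] [Module.Finite K M] [Module.Finite K V] :
    Finite (IsometricEmb β h) :=
  have : Finite M := Module.finite_of_finite K
  have : Finite V := Module.finite_of_finite K
  have : Finite (M →ₗ[K] V) := DFunLike.finite _
  Finite.of_injective IsometricEmb.toLinearMap fun _ _ => IsometricEmb.ext

instance : MulAction (isometryGroup h) (IsometricEmb β h) where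
  smul e f := ⟨e.1.toLinearMap ∘ₗ f.toLinearMap, e.1.injective.comp f.injective,
    LinearMap.ext₂ fun x y => (form_isometry_apply e _ _).trans (f.apply_apply x y)⟩
  one_smul _ := rfl
  mul_smul _ _ _ := rfl

theorem isPretransitive_isometricEmb [FiniteDimensional K V] (hσ : Function.Involutive σ)
    (hne : σ ≠ RingHom.id K) (hh : h.IsSymm) (hnd : h.Nondegenerate) :
    MulAction.IsPretransitive (isometryGroup h) (IsometricEmb β h) where
  exists_smul_eq f g := by
    obtain ⟨e, he⟩ := exists_isometry_comp_eq hσ hne hh hnd f.injective g.injective fun x y =>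
      (f.apply_apply x y).trans (g.apply_apply x y).symm
    exact ⟨e, IsometricEmb.ext he⟩

/-- Precomposition of an isometric embedding of `(M, β)` with an isometry `T` of `β`. -/
def IsometricEmb.precomp {T : Module.End K M} (hT : Function.Injective T)
    (hβ : pullback β T = β) (f : IsometricEmb β h) : IsometricEmb β h :=
  ⟨f.toLinearMap ∘ₗ T, f.injective.comp hT, LinearMap.ext₂ fun x y =>
    (f.apply_apply (T x) (T y)).trans (LinearMap.congr_fun₂ hβ x y)⟩

end Action

/-- Sorts the equivariant embeddings of `(M, T)` into `(V, e)` by the form they induce on `M`. -/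
def equivariantEmbEquiv (hh : h.IsSymm) {T : Module.End K M} (hT : Function.Injective T)
    (e : isometryGroup h) :
    equivariantEmb T e.1.toLinearMap ≃
      Σ β : invariantHermitianForms σ T,
        {f : IsometricEmb β.1 h // e • f = f.precomp hT β.2.2} where
  toFun f := ⟨⟨pullback h f.1, ⟨fun _ _ => hh.eq _ _⟩, by
      have hf : ∀ x, f.1 (T x) = e.1 (f.1 x) := LinearMap.congr_fun f.2.2
      ext x y
      rw [pullback_apply, pullback_apply, pullback_apply, hf, hf, form_isometry_apply]⟩,
    ⟨f.1, f.2.1, rfl⟩, IsometricEmb.ext f.2.2.symm⟩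
  invFun p := ⟨p.2.1.toLinearMap, p.2.1.injective,
    (congrArg IsometricEmb.toLinearMap p.2.2).symm⟩
  right_inv := by
    rintro ⟨⟨β, hβ⟩, ⟨f, hf, hfβ⟩, hef⟩
    change pullback h f = β at hfβ
    subst hfβ
    rfl

theorem sum_ncard_equivariantEmb [Finite K] [FiniteDimensional K V] [FiniteDimensional K M]
    (hh : h.IsSymm) {T : Module.End K M} (hT : Function.Injective T)
    {N : Type*} [Group N] [Fintype N] (ρ : N →* isometryGroup h) (e : isometryGroup h)
    (hρ : ∀ β ∈ invariantHermitianForms σ T, ∀ f f' : IsometricEmb β h, ∃ a, ρ a • f = f') :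
    ∑ a, (equivariantEmb T (e * ρ a).1.toLinearMap).ncard =
      {β ∈ invariantHermitianForms σ T | Nonempty (IsometricEmb β h)}.ncard * Nat.card N := by
  classical
  have : Finite (M →ₛₗ[σ] M →ₗ[K] K) := finite_sesquilinear
  have (β : M →ₛₗ[σ] M →ₗ[K] K) : Finite (IsometricEmb β h) := finite_isometricEmb
  have := Fintype.ofFinite (invariantHermitianForms σ T)
  have count (β : invariantHermitianForms σ T) :
      ∑ a, Nat.card {f : IsometricEmb β.1 h // (e * ρ a) • f = f.precomp hT β.2.2} =
        if Nonempty (IsometricEmb β.1 h) then Nat.card N else 0 := by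
    split_ifs with hβ
    · exact sum_natCard_smul_eq ρ (hρ β β.2) e _
    · have := not_nonempty_iff.1 hβ
      simp
  simp only [← Nat.card_coe_set_eq, Nat.card_congr (equivariantEmbEquiv hh hT _), Nat.card_sigma]
  rw [Finset.sum_comm, Finset.sum_congr rfl fun β _ => count β, ← Finset.sum_filter,
    Finset.sum_const, smul_eq_mul, ← Fintype.card_subtype, ← Nat.card_eq_fintype_card]
  congr 1
  exact Nat.card_congr ((Equiv.subtypeSubtypeEquivSubtypeInter
    (· ∈ invariantHermitianForms σ T) fun β => Nonempty (IsometricEmb β h)))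

end Forms

section HermitianCount

variable {K M : Type*} [Field K] {σ : K →+* K} [AddCommGroup M] [Module K M]

theorem eq_and_eq_of_isSymm_of_add_smul_eq {θ : K} (hθ : σ θ ≠ θ)
    {a b a' b' : M →ₛₗ[σ] M →ₗ[K] K} (ha : a.IsSymm) (hb : b.IsSymm) (ha' : a'.IsSymm)
    (hb' : b'.IsSymm) (h : a + θ • b = a' + θ • b') : a = a' ∧ b = b' := by
  have apply_eq (x y : M) : a x y + θ * b x y = a' x y + θ * b' x y := LinearMap.congr_fun₂ h x y
  have hb_eq : b = b' := by
    ext x y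
    have conj_eq := congrArg σ (apply_eq y x)
    simp only [map_add, map_mul, ha.eq, hb.eq, ha'.eq, hb'.eq] at conj_eq
    refine mul_left_cancel₀ (sub_ne_zero.2 hθ) ?_
    linear_combination conj_eq - apply_eq x y
  subst hb_eq
  exact ⟨LinearMap.ext₂ fun x y => add_right_cancel (apply_eq x y), rfl⟩

/-- The adjoint `(x, y) ↦ σ (β y x)` of a sesquilinear form. -/
def adjointForm (hσ : Function.Involutive σ) (β : M →ₛₗ[σ] M →ₗ[K] K) : M →ₛₗ[σ] M →ₗ[K] K :=
  LinearMap.mk₂'ₛₗ σ (RingHom.id K) (fun x y => σ (β y x))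
    (fun _ _ _ => by rw [map_add, map_add])
    (fun _ _ _ => by rw [map_smul, smul_eq_mul, map_mul, smul_eq_mul])
    (fun _ _ _ => by rw [map_add, LinearMap.add_apply, map_add])
    (fun _ _ _ => by
      rw [map_smulₛₗ, LinearMap.smul_apply, smul_eq_mul, map_mul, hσ, smul_eq_mul,
        RingHom.id_apply])

theorem exists_invariantHermitianForms_add_smul_eq (hσ : Function.Involutive σ) {θ : K}
    (hθ : σ θ ≠ θ) {T : Module.End K M} {β : M →ₛₗ[σ] M →ₗ[K] K} (hβ : β ∈ invariantForms σ T) :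
    ∃ a ∈ invariantHermitianForms σ T, ∃ b ∈ invariantHermitianForms σ T, a + θ • b = β := by
  have hθ₁ : θ - σ θ ≠ 0 := sub_ne_zero.2 hθ.symm
  have hθ₂ : σ θ - θ ≠ 0 := sub_ne_zero.2 hθ
  have invariant (x y : M) : β (T x) (T y) = β x y := LinearMap.congr_fun₂ hβ x y
  let b := (θ - σ θ)⁻¹ • (β - adjointForm hσ β)
  have b_apply (x y : M) : b x y = (θ - σ θ)⁻¹ * (β x y - σ (β y x)) := rfl
  have b_conj (x y : M) : σ (b x y) = b y x := by
    rw [b_apply, b_apply, map_mul, map_inv₀, map_sub, map_sub, hσ, hσ]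
    field_simp
    ring
  have b_invariant (x y : M) : b (T x) (T y) = b x y := by
    rw [b_apply, b_apply, invariant, invariant]
  refine ⟨β - θ • b, ⟨⟨fun x y => ?_⟩, ?_⟩, b, ⟨⟨b_conj⟩, LinearMap.ext₂ b_invariant⟩,
    LinearMap.ext₂ fun _ _ => sub_add_cancel _ _⟩
  · change σ (β x y - θ * b x y) = β y x - θ * b y x
    rw [map_sub, map_mul, b_conj, b_apply]
    field_simp
    ring
  · ext x y
    change β (T x) (T y) - θ * b (T x) (T y) = β x y - θ * b x y
    rw [invariant, b_invariant]

theorem ncard_invariantHermitianForms_sq (hσ : Function.Involutive σ) (hne : σ ≠ RingHom.id K)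
    (T : Module.End K M) :
    (invariantHermitianForms σ T).ncard ^ 2 = (invariantForms σ T).ncard := by
  obtain ⟨θ, hθ : σ θ ≠ θ⟩ := DFunLike.ne_iff.1 hne
  have image_eq : (fun p => p.1 + θ • p.2) ''
      invariantHermitianForms σ T ×ˢ invariantHermitianForms σ T = invariantForms σ T := by
    refine subset_antisymm ?_ fun β hβ => ?_
    · rintro _ ⟨p, ⟨⟨-, hp₁⟩, ⟨-, hp₂⟩⟩, rfl⟩
      ext x y
      exact congrArg₂ (· + θ * ·) (LinearMap.congr_fun₂ hp₁ x y) (LinearMap.congr_fun₂ hp₂ x y)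
    · obtain ⟨a, ha, b, hb, rfl⟩ := exists_invariantHermitianForms_add_smul_eq hσ hθ hβ
      exact ⟨(a, b), ⟨ha, hb⟩, rfl⟩
  rw [← image_eq, Set.InjOn.ncard_image, Set.ncard_prod, sq]
  rintro ⟨a, b⟩ ⟨ha, hb⟩ ⟨a', b'⟩ ⟨ha', hb'⟩ h
  obtain ⟨rfl, rfl⟩ := eq_and_eq_of_isSymm_of_add_smul_eq hθ ha.1 hb.1 ha'.1 hb'.1 h
  rfl

end HermitianCount

section StandardForm

variable {K : Type*} [Field K] {σ : K →+* K} {ι κ : Type*} [Fintype ι] [Fintype κ]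

variable (σ ι) in
/-- The standard Hermitian form `∑ σ(xᵢ) yᵢ`. -/
def stdForm : (ι → K) →ₛₗ[σ] (ι → K) →ₗ[K] K :=
  LinearMap.mk₂'ₛₗ σ (RingHom.id K) (fun x y => (σ ∘ x) ⬝ᵥ y)
    (fun x x' y => by rw [← add_dotProduct]; congr 1; ext; exact map_add _ _ _)
    (fun c x y => by rw [← smul_dotProduct]; congr 1; ext; exact map_mul _ _ _)
    (fun _ _ _ => dotProduct_add _ _ _)
    (fun _ _ _ => dotProduct_smul _ _ _)

theorem stdForm_apply (x y : ι → K) : stdForm σ ι x y = ∑ i, σ (x i) * y i := rfl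

theorem isSymm_stdForm (hσ : Function.Involutive σ) : (stdForm σ ι).IsSymm where
  eq x y := by simp only [stdForm_apply, map_sum, map_mul, hσ (x _), mul_comm]

theorem nondegenerate_stdForm : (stdForm σ ι).Nondegenerate := by
  classical
  refine ⟨fun x hx => ?_, fun y hy => ?_⟩
  · ext i
    simpa [stdForm_apply, Pi.single_apply] using hx (Pi.single i 1)
  · ext i
    simpa [stdForm_apply, Pi.single_apply, apply_ite σ] using hy (Pi.single i 1)

theorem stdForm_extendByZero {e : ι → κ} (he : Function.Injective e) (x y : ι → K) :
    stdForm σ κ (Function.ExtendByZero.linearMap K e x) (Function.ExtendByZero.linearMap K e y) =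
      stdForm σ ι x y := by
  refine (Fintype.sum_of_injective e he _ _ (fun k hk => ?_) fun i => ?_).symm
  · simp [Function.extend_apply' _ _ _ hk]
  · simp [he.extend_apply]

theorem stdForm_mulVec (A : Matrix ι ι K) (x y : ι → K) :
    stdForm σ ι (A.mulVec x) (A.mulVec y) =
      stdForm σ ι x (((A.map σ).transpose * A).mulVec y) := by
  change (σ ∘ A.mulVec x) ⬝ᵥ A.mulVec y = (σ ∘ x) ⬝ᵥ _
  have conj_mulVec : σ ∘ A.mulVec x = (A.map σ).mulVec (σ ∘ x) :=
    funext fun i => RingHom.map_mulVec σ A x i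
  rw [conj_mulVec, ← Matrix.mulVec_mulVec, Matrix.dotProduct_mulVec (σ ∘ x),
    Matrix.vecMul_transpose]

theorem forall_stdForm_mulVec_eq_iff [DecidableEq ι] {A : Matrix ι ι K} :
    (∀ x y, stdForm σ ι (A.mulVec x) (A.mulVec y) = stdForm σ ι x y) ↔
      A * (A.map σ).transpose = 1 := by
  rw [mul_eq_one_comm]
  refine ⟨fun h => Matrix.mulVec_injective ?_, fun h x y => by
    rw [stdForm_mulVec, h, Matrix.one_mulVec]⟩
  funext y
  rw [Matrix.one_mulVec, ← sub_eq_zero]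
  refine (nondegenerate_stdForm (σ := σ)).2 _ fun x => ?_
  rw [map_sub, ← stdForm_mulVec, h, sub_self]

/-- Embed by `x ↦ (xᵢ + ℓᵢ(x), ε ℓᵢ(x))` with `ℓᵢ(x) = τ (β(bᵢ, x) - xᵢ)`. -/
theorem nonempty_isometricEmb_stdForm_sum {τ ε : K}
    (hτ : τ + σ τ = 1) (hε : σ ε * ε = -1) {M : Type*} [AddCommGroup M] [Module K M]
    (b : Module.Basis ι K M) {β : M →ₛₗ[σ] M →ₗ[K] K} (hβ : β.IsSymm) :
    Nonempty (IsometricEmb β (stdForm σ (ι ⊕ ι))) := by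
  let ℓ (i : ι) : M →ₗ[K] K := τ • (β (b i) - b.coord i)
  let f : M →ₗ[K] ι ⊕ ι → K :=
    LinearMap.pi (Sum.elim (fun i => b.coord i + ℓ i) fun i => ε • ℓ i)
  have hℓ (x : M) (i : ι) : ℓ i x = τ * (β (b i) x - b.repr x i) := rfl
  have hf₁ (x : M) (i : ι) : f x (Sum.inl i) = b.repr x i + ℓ i x := rfl
  have hf₂ (x : M) (i : ι) : f x (Sum.inr i) = ε * ℓ i x := rfl
  refine ⟨f, ?_, ?_⟩
  · rw [injective_iff_map_eq_zero]
    intro x hx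
    have hε₀ : ε ≠ 0 := by
      rintro rfl
      simp at hε
    have ℓ_eq_zero (i : ι) : ℓ i x = 0 := by
      simpa [hε₀, hx] using (hf₂ x i).symm
    refine b.repr.map_eq_zero_iff.1 (Finsupp.ext fun i => ?_)
    simpa [hx, ℓ_eq_zero] using (hf₁ x i).symm
  · ext x y
    have expand_left : ∑ i, σ (b.repr x i) * β (b i) y = β x y := by
      conv_rhs => rw [← b.sum_repr x]
      simp only [map_sum, map_smulₛₗ, LinearMap.sum_apply, LinearMap.smul_apply, smul_eq_mul]
    have expand_right : ∑ i, b.repr y i * β x (b i) = β x y := by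
      conv_rhs => rw [← b.sum_repr y]
      simp only [map_sum, map_smul, smul_eq_mul]
    have hτ' : σ τ = 1 - τ := by linear_combination hτ
    rw [pullback_apply, stdForm_apply, Fintype.sum_sum_type, ← Finset.sum_add_distrib]
    calc
      _ = ∑ i, (τ * (σ (b.repr x i) * β (b i) y) + (1 - τ) * (b.repr y i * β x (b i))) := by
        refine Finset.sum_congr rfl fun i _ => ?_
        simp only [hf₁, hf₂, hℓ, map_add, map_mul, map_sub, hτ', hβ.eq]
        linear_combination (1 - τ) * (β x (b i) - σ (b.repr x i)) * τ *
          (β (b i) y - b.repr y i) * hε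
      _ = β x y := by
        rw [Finset.sum_add_distrib, ← Finset.mul_sum, ← Finset.mul_sum, expand_left, expand_right]
        ring

theorem exists_isometricEmb_stdForm_apply_eq_zero {τ ε : K} (hτ : τ + σ τ = 1) (hε : σ ε * ε = -1)
    {M : Type*} [AddCommGroup M] [Module K M] [FiniteDimensional K M]
    (hκ : 2 * Module.finrank K M < Fintype.card κ)
    {β : M →ₛₗ[σ] M →ₗ[K] K} (hβ : β.IsSymm) :
    ∃ f : IsometricEmb β (stdForm σ κ), ∃ k, ∀ x, f.toLinearMap x k = 0 := by
  obtain ⟨f⟩ := nonempty_isometricEmb_stdForm_sum hτ hε (Module.finBasis K M) hβ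
  have hcard : Fintype.card (Fin (Module.finrank K M) ⊕ Fin (Module.finrank K M)) <
      Fintype.card κ := by
    rwa [Fintype.card_sum, Fintype.card_fin, ← two_mul]
  obtain ⟨e⟩ := Function.Embedding.nonempty_of_card_le hcard.le
  obtain ⟨k, hk⟩ : ∃ k, k ∉ Set.range e := by
    by_contra! h
    exact hcard.not_ge (Fintype.card_le_of_surjective e h)
  refine ⟨⟨Function.ExtendByZero.linearMap K e ∘ₗ f.toLinearMap, ?_, ?_⟩, k, fun x => ?_⟩
  · exact (Function.extend_injective e.injective (0 : κ → K)).comp f.injective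
  · ext x y
    exact (stdForm_extendByZero e.injective _ _).trans (f.apply_apply x y)
  · exact Function.extend_apply' _ _ _ hk

end StandardForm

section Unitary

variable {F K : Type*} [Field F] [Fintype F] [Field K] [Algebra F K] {n : ℕ}

/-- A unitary matrix as an isometry of the standard Hermitian form. -/
def unitaryIsometry : GU F K n →* isometryGroup (stdForm (conj F K) (Fin n)) :=
  (((LinearMap.GeneralLinearGroup.generalLinearEquiv K (Fin n → K)).toMonoidHom.comp
    Matrix.GeneralLinearGroup.toLin.toMonoidHom).comp (GU F K n).subtype).codRestrict _
      fun A => forall_stdForm_mulVec_eq_iff.2 A.2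

theorem unitaryIsometry_toLinearMap (A : GU F K n) :
    (unitaryIsometry A).1.toLinearMap = Matrix.toLin' A.1.1 := rfl

theorem unitaryIsometry_surjective :
    Function.Surjective (unitaryIsometry : GU F K n →* _) := fun e => by
  obtain ⟨u, hu⟩ :=
    (LinearMap.GeneralLinearGroup.generalLinearEquiv K (Fin n → K)).surjective e.1
  obtain ⟨g, rfl⟩ := Matrix.GeneralLinearGroup.toLin.surjective u
  have hg (x : Fin n → K) : g.1.mulVec x = e.1 x := LinearEquiv.congr_fun hu x
  exact ⟨⟨g, forall_stdForm_mulVec_eq_iff.1 fun x y => by rw [hg, hg, form_isometry_apply]⟩,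
    Subtype.ext (LinearEquiv.ext hg)⟩

theorem conj_det_mul_det (A : GU F K n) :
    Matrix.det A.1.1 * conj F K (Matrix.det A.1.1) = 1 := by
  have h := congrArg Matrix.det A.2
  rw [Matrix.det_mul, Matrix.det_transpose, Matrix.det_one] at h
  rw [← h, RingHom.map_det]
  rfl

theorem exists_unitary_det_eq (i : Fin n) {c : K} (hc : c * conj F K c = 1) :
    ∃ A : GU F K n, Matrix.det A.1.1 = c ∧ ∀ x, x i = 0 → A.1.1.mulVec x = x := by
  let d : Fin n → K := Pi.mulSingle i c
  have hd (j : Fin n) : d j * conj F K (d j) = 1 := by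
    obtain rfl | hj := eq_or_ne j i
    · simpa [d] using hc
    · simp [d, hj]
  have unitary : Matrix.diagonal d * ((Matrix.diagonal d).map (conj F K)).transpose = 1 := by
    rw [Matrix.diagonal_map (map_zero _), Matrix.diagonal_transpose, Matrix.diagonal_mul_diagonal,
      ← Matrix.diagonal_one]
    exact congrArg Matrix.diagonal (funext hd)
  refine ⟨⟨Matrix.GeneralLinearGroup.mk'' _ (Matrix.isUnit_det_of_right_inverse unitary),
    unitary⟩, ?_, fun x hx => ?_⟩
  · change (Matrix.diagonal d).det = c
    rw [Matrix.det_diagonal, Finset.prod_pi_mulSingle']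
    simp
  · change (Matrix.diagonal d).mulVec x = x
    ext j
    rw [Matrix.mulVec_diagonal]
    obtain rfl | hj := eq_or_ne j i
    · rw [hx, mul_zero]
    · simp [d, hj]

variable {M : Type*} [AddCommGroup M] [Module K M]

theorem exists_unitaryIsometry_smul_eq (hK : Module.finrank F K = 2)
    {β : M →ₛₗ[conj F K] M →ₗ[K] K} (f f' : IsometricEmb β (stdForm (conj F K) (Fin n))) :
    ∃ A : GU F K n, unitaryIsometry A • f = f' := by
  have := isPretransitive_isometricEmb (β := β) (h := stdForm (conj F K) (Fin n))
    (conj_involutive hK) (conj_ne_id hK) (isSymm_stdForm (conj_involutive hK))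
    nondegenerate_stdForm
  obtain ⟨e, rfl⟩ := MulAction.exists_smul_eq (isometryGroup (stdForm (conj F K) (Fin n))) f f'
  obtain ⟨A, rfl⟩ := unitaryIsometry_surjective e
  exact ⟨A, rfl⟩

variable [FiniteDimensional K M]

theorem exists_isometricEmb_unitary (hK : Module.finrank F K = 2)
    (hn : 2 * Module.finrank K M < n) {β : M →ₛₗ[conj F K] M →ₗ[K] K} (hβ : β.IsSymm) :
    ∃ f : IsometricEmb β (stdForm (conj F K) (Fin n)), ∃ k, ∀ x, f.toLinearMap x k = 0 := by
  obtain ⟨τ, hτ⟩ := exists_add_apply_eq_one (conj_involutive hK) (conj_ne_id hK)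
  obtain ⟨ε, hε⟩ := exists_conj_mul_eq_neg_one hK
  exact exists_isometricEmb_stdForm_apply_eq_zero hτ hε (by rwa [Fintype.card_fin]) hβ

theorem exists_SU_unitaryIsometry_smul_eq (hK : Module.finrank F K = 2)
    (hn : 2 * Module.finrank K M < n) {β : M →ₛₗ[conj F K] M →ₗ[K] K} (hβ : β.IsSymm)
    (f f' : IsometricEmb β (stdForm (conj F K) (Fin n))) :
    ∃ A : SU F K n, unitaryIsometry A.1 • f = f' := by
  let _ : MulAction (GU F K n) (IsometricEmb β (stdForm (conj F K) (Fin n))) :=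
    MulAction.compHom _ unitaryIsometry
  have : MulAction.IsPretransitive (GU F K n) (IsometricEmb β (stdForm (conj F K) (Fin n))) :=
    ⟨exists_unitaryIsometry_smul_eq hK⟩
  obtain ⟨f₀, k, hk⟩ := exists_isometricEmb_unitary hK hn hβ
  have := isPretransitive_subgroup_of_stabilizer (N := SU F K n) f₀ fun A => by
    obtain ⟨E, hE, hfix⟩ := exists_unitary_det_eq k (conj_det_mul_det A⁻¹)
    refine ⟨E, IsometricEmb.ext (LinearMap.ext fun x => hfix _ (hk x)), ?_⟩
    have det_eq : Matrix.GeneralLinearGroup.det E.1 = Matrix.GeneralLinearGroup.det A⁻¹.1 :=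
      Units.ext hE
    change Matrix.GeneralLinearGroup.det (A.1 * E.1) = 1
    rw [map_mul, det_eq, ← map_mul, InvMemClass.coe_inv, mul_inv_cancel, map_one]
  exact MulAction.exists_smul_eq (SU F K n) f f'

variable {T : Module.End K M}

theorem sum_SU_ncard_equivariantEmb (hK : Module.finrank F K = 2) [Fintype (SU F K n)]
    (hn : 2 * Module.finrank K M < n) (hT : Function.Injective T) (A : GU F K n) :
    ∑ B : SU F K n, (equivariantEmb T (Matrix.toLin' (A * B.1).1.1)).ncard =
      (invariantHermitianForms (conj F K) T).ncard * Nat.card (SU F K n) := by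
  have := finite_of_finrank_eq_two hK
  have total := sum_ncard_equivariantEmb (isSymm_stdForm (conj_involutive hK)) hT
    (unitaryIsometry.comp (SU F K n).subtype) (unitaryIsometry A) fun β hβ =>
      exists_SU_unitaryIsometry_smul_eq hK hn hβ.1
  simp only [MonoidHom.comp_apply, Subgroup.subtype_apply, ← map_mul,
    unitaryIsometry_toLinearMap] at total
  rwa [Set.sep_eq_self_iff_mem_true.2 fun β hβ =>
    (exists_isometricEmb_unitary hK hn hβ.1).nonempty] at total

theorem sum_SU_ncard_equivariantEmb_le (hK : Module.finrank F K = 2) [Fintype (SU F K n)]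
    (hT : Function.Injective T) (A : GU F K n) :
    ∑ B : SU F K n, (equivariantEmb T (Matrix.toLin' (A * B.1).1.1)).ncard ≤
      (invariantHermitianForms (conj F K) T).ncard * (Nat.card Kˣ * Nat.card (SU F K n)) := by
  have := finite_of_finrank_eq_two hK
  have := Fintype.ofFinite (GU F K n)
  have total := sum_ncard_equivariantEmb (isSymm_stdForm (conj_involutive hK)) hT
    unitaryIsometry (unitaryIsometry A) fun _ _ => exists_unitaryIsometry_smul_eq hK
  simp only [← map_mul, unitaryIsometry_toLinearMap] at total
  have : Finite (M →ₛₗ[conj F K] M →ₗ[K] K) := finite_sesquilinear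
  calc
    _ ≤ ∑ B : GU F K n, (equivariantEmb T (Matrix.toLin' (A * B).1.1)).ncard :=
      (Finset.sum_map _ (Function.Embedding.subtype _) _).symm.trans_le
        (Finset.sum_le_sum_of_subset (Finset.subset_univ _))
    _ ≤ (invariantHermitianForms (conj F K) T).ncard * Nat.card (GU F K n) :=
      total.le.trans (Nat.mul_le_mul_right _ (Set.ncard_le_ncard (Set.sep_subset _ _)))
    _ ≤ _ := by
      rw [← Subgroup.index_mul_card (SU F K n), SU, Subgroup.index_ker]
      gcongr
      exact Subgroup.card_le_card_group _

end Unitary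

section KerAeval

variable {K M N : Type*} [Field K] [AddCommGroup M] [Module K M] [AddCommGroup N] [Module K N]

theorem comp_aeval_eq {T : Module.End K M} {D : Module.End K N} {g : M →ₗ[K] N}
    (h : g ∘ₗ T = D ∘ₗ g) (p : K[X]) (x : M) : g (aeval T p x) = aeval D p (g x) := by
  induction p using Polynomial.induction_on generalizing x with
  | C a => simp [Module.algebraMap_end_apply]
  | add p q hp hq =>
    rw [map_add, map_add, LinearMap.add_apply, LinearMap.add_apply, map_add, hp, hq]
  | monomial n a ih =>
    have hT : g (T x) = D (g x) := LinearMap.congr_fun h x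
    rw [pow_succ, ← mul_assoc, map_mul (aeval T), map_mul (aeval D), aeval_X, aeval_X,
      Module.End.mul_apply, Module.End.mul_apply, ih, hT]

/-- The kernel of `f(D)`, on which `K[X] / (f)` acts through `D`. -/
abbrev kerAeval (D : Module.End K N) (f : K[X]) : Submodule K N := LinearMap.ker (aeval D f)

theorem apply_mem_kerAeval (D : Module.End K N) (f : K[X]) : ∀ v ∈ kerAeval D f,
    D v ∈ kerAeval D f := fun v hv => by
  rw [LinearMap.mem_ker] at hv ⊢
  rw [← comp_aeval_eq rfl, hv, map_zero]

theorem coe_aeval_restrict (D : Module.End K N) (f p : K[X]) (v : kerAeval D f) :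
    (aeval (D.restrict (apply_mem_kerAeval D f)) p v : N) = aeval D p v :=
  comp_aeval_eq (g := (kerAeval D f).subtype) rfl p v

/-- The action of `K[X] / (f)` on the kernel of `f(D)`, in which the root of `f` acts as `D`. -/
def kerAevalHom (D : Module.End K N) (f : K[X]) : AdjoinRoot f →ₐ[K] Module.End K (kerAeval D f) :=
  Ideal.Quotient.liftₐ _ (aeval (D.restrict (apply_mem_kerAeval D f))) fun p hp => by
    obtain ⟨r, rfl⟩ := Ideal.mem_span_singleton'.1 hp
    ext v
    rw [coe_aeval_restrict, map_mul, Module.End.mul_apply, LinearMap.mem_ker.1 v.2, map_zero]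
    rfl

instance (D : Module.End K N) (f : K[X]) : Module (AdjoinRoot f) (kerAeval D f) :=
  Module.compHom _ (kerAevalHom D f).toRingHom

theorem mk_smul_kerAeval (D : Module.End K N) (f p : K[X]) (v : kerAeval D f) :
    ((AdjoinRoot.mk f p • v : kerAeval D f) : N) = aeval D p v :=
  coe_aeval_restrict D f p v

instance (D : Module.End K N) (f : K[X]) : IsScalarTower K (AdjoinRoot f) (kerAeval D f) where
  smul_assoc c x v := LinearMap.congr_fun (map_smul (kerAevalHom D f) c x) v

theorem natCard_adjoinRoot [Finite K] {f : K[X]} (hf : f ≠ 0) :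
    Nat.card (AdjoinRoot f) = Nat.card K ^ f.natDegree := by
  have := (AdjoinRoot.powerBasis hf).finite
  rw [Module.natCard_eq_pow_finrank (K := K), (AdjoinRoot.powerBasis hf).finrank,
    AdjoinRoot.powerBasis_dim]

theorem eq_zero_of_sum_kerAeval {ι : Type*} [Fintype ι] {φ : ι → K[X]}
    (hφ : Pairwise fun s s' => IsCoprime (φ s) (φ s')) {D : Module.End K N}
    (y : (s : ι) → kerAeval D (φ s)) (hy : ∑ s, (y s : N) = 0) (s : ι) : y s = 0 := by
  classical
  have coprime : IsCoprime (φ s) (∏ r ∈ Finset.univ.erase s, φ r) :=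
    IsCoprime.prod_right fun r hr => hφ (Finset.ne_of_mem_erase hr).symm
  have killed (r : ι) (hr : r ≠ s) : aeval D (∏ r ∈ Finset.univ.erase s, φ r) (y r : N) = 0 := by
    rw [← Finset.prod_erase_mul _ _ (Finset.mem_erase.2 ⟨hr, Finset.mem_univ r⟩), map_mul,
      Module.End.mul_apply, LinearMap.mem_ker.1 (y r).2, map_zero]
  have killed_self : aeval D (∏ r ∈ Finset.univ.erase s, φ r) (y s : N) = 0 := by
    rw [← Fintype.sum_eq_single s killed, ← map_sum, hy, map_zero]
  exact Subtype.ext <| Submodule.disjoint_def.1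
    (Polynomial.disjoint_ker_aeval_of_isCoprime D coprime) _ (y s).2 killed_self

end KerAeval

section CyclicSum

variable {K : Type*} [Field K] {ι : Type*} (φ : ι → K[X]) (k : ι → ℕ)

/-- The `K[X]`-module `⨁ s, (K[X] / (φ s)) ^ (k s)`, as a module over `∏ s, K[X] / (φ s)`. -/
abbrev CyclicSum : Type _ := (s : ι) → Fin (k s) → AdjoinRoot (φ s)

/-- Multiplication on `⨁ s, (K[X] / (φ s)) ^ (k s)` by an element of each factor. -/
def mulBy (a : (s : ι) → AdjoinRoot (φ s)) : Module.End K (CyclicSum φ k) :=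
  Algebra.lsmul K K (CyclicSum φ k) a

/-- The action of the variable on `⨁ s, (K[X] / (φ s)) ^ (k s)`. -/
abbrev mulRoot : Module.End K (CyclicSum φ k) := mulBy φ k fun s => AdjoinRoot.root (φ s)

variable {φ k}

theorem mulBy_apply (a : (s : ι) → AdjoinRoot (φ s)) (x : CyclicSum φ k) (s : ι) (i : Fin (k s)) :
    mulBy φ k a x s i = a s * x s i := rfl

theorem aeval_mulBy (a : (s : ι) → AdjoinRoot (φ s)) (p : K[X]) :
    aeval (mulBy φ k a) p = mulBy φ k fun s => aeval (a s) p := by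
  rw [mulBy, Polynomial.aeval_algHom_apply, Polynomial.aeval_pi_apply]
  rfl

theorem aeval_mulRoot_single [DecidableEq ι] (p : K[X]) (s : ι) (i : Fin (k s)) :
    aeval (mulRoot φ k) p (Pi.single s (Pi.single i 1)) =
      Pi.single s (Pi.single i (AdjoinRoot.mk (φ s) p)) := by
  ext s' i'
  rw [aeval_mulBy, mulBy_apply, AdjoinRoot.aeval_eq]
  obtain rfl | hs := eq_or_ne s' s
  · obtain rfl | hi := eq_or_ne i' i
    · simp
    · simp [hi]
  · simp [Pi.single_eq_of_ne hs]

variable [Fintype ι] {N : Type*} [AddCommGroup N] [Module K N] {D : Module.End K N}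

/-- The equivariant map out of `⨁ s, (K[X] / (φ s)) ^ (k s)` with prescribed values at the
generators. -/
def ofKerAeval (v : (s : ι) → Fin (k s) → kerAeval D (φ s)) : CyclicSum φ k →ₗ[K] N where
  toFun x := ∑ s, ((∑ i, x s i • v s i : kerAeval D (φ s)) : N)
  map_add' x y := by
    simp only [Pi.add_apply, add_smul, Finset.sum_add_distrib, Submodule.coe_add]
  map_smul' c x := by
    simp only [Pi.smul_apply, smul_assoc, ← Finset.smul_sum, Submodule.coe_smul, RingHom.id_apply]

theorem ofKerAeval_apply (v : (s : ι) → Fin (k s) → kerAeval D (φ s)) (x : CyclicSum φ k) :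
    ofKerAeval v x = ∑ s, ((∑ i, x s i • v s i : kerAeval D (φ s)) : N) := rfl

theorem ofKerAeval_comp_mulRoot (v : (s : ι) → Fin (k s) → kerAeval D (φ s)) :
    ofKerAeval v ∘ₗ mulRoot φ k = D ∘ₗ ofKerAeval v := by
  refine LinearMap.ext fun x => ?_
  have root_smul (s : ι) (w : kerAeval D (φ s)) : ((AdjoinRoot.root (φ s) • w : kerAeval D _) : N) =
      D w := by
    rw [← AdjoinRoot.mk_X, mk_smul_kerAeval, aeval_X]
  rw [LinearMap.comp_apply, LinearMap.comp_apply, ofKerAeval_apply, ofKerAeval_apply, map_sum]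
  refine Finset.sum_congr rfl fun s _ => ?_
  simp only [mulBy_apply, mul_smul, ← Finset.smul_sum, root_smul]

theorem ofKerAeval_single [DecidableEq ι] (v : (s : ι) → Fin (k s) → kerAeval D (φ s)) (s : ι)
    (c : Fin (k s) → AdjoinRoot (φ s)) :
    ofKerAeval v (Pi.single s c) = ((∑ i, c i • v s i : kerAeval D (φ s)) : N) := by
  rw [ofKerAeval_apply, Fintype.sum_eq_single s fun r hr => by simp [Pi.single_eq_of_ne hr],
    Pi.single_eq_same]

theorem eq_ofKerAeval [DecidableEq ι] {g : CyclicSum φ k →ₗ[K] N}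
    (hg : g ∘ₗ mulRoot φ k = D ∘ₗ g) {v : (s : ι) → Fin (k s) → kerAeval D (φ s)}
    (hv : ∀ s i, g (Pi.single s (Pi.single i 1)) = v s i) : g = ofKerAeval v := by
  have apply_single (s : ι) (i : Fin (k s)) (c : AdjoinRoot (φ s)) :
      g (Pi.single s (Pi.single i c)) = ((c • v s i : kerAeval D (φ s)) : N) := by
    obtain ⟨p, rfl⟩ := AdjoinRoot.mk_surjective c
    rw [mk_smul_kerAeval, ← hv, ← comp_aeval_eq hg, aeval_mulRoot_single]
  have decomposition (x : CyclicSum φ k) :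
      x = ∑ s, ∑ i, (Pi.single s (Pi.single i (x s i)) : CyclicSum φ k) := by
    simp only [← LinearMap.coe_single K (fun s => Fin (k s) → AdjoinRoot (φ s)), ← map_sum,
      Finset.univ_sum_single]
    exact (Finset.univ_sum_single x).symm
  refine LinearMap.ext fun x => ?_
  conv_lhs => rw [decomposition x]
  simp only [map_sum, apply_single, ofKerAeval_apply, AddSubmonoidClass.coe_finsetSum]

/-- An equivariant map out of `⨁ s, (K[X] / (φ s)) ^ (k s)` amounts to a family of vectors, the
images of the generators, killed by the respective `φ s`. -/
def equivariantEquiv [DecidableEq ι] :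
    {g : CyclicSum φ k →ₗ[K] N // g ∘ₗ mulRoot φ k = D ∘ₗ g} ≃
    ((s : ι) → Fin (k s) → kerAeval D (φ s)) where
  toFun g s i := ⟨g.1 (Pi.single s (Pi.single i 1)), by
    rw [LinearMap.mem_ker, ← comp_aeval_eq g.2, aeval_mulRoot_single, AdjoinRoot.mk_self,
      Pi.single_zero, Pi.single_zero, map_zero]⟩
  invFun v := ⟨ofKerAeval v, ofKerAeval_comp_mulRoot v⟩
  left_inv g := Subtype.ext (eq_ofKerAeval g.2 fun _ _ => rfl).symm
  right_inv v := by
    ext s i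
    change ofKerAeval v (Pi.single s (Pi.single i 1)) = _
    rw [ofKerAeval_single, Fintype.sum_eq_single i fun j hj => by simp [hj], Pi.single_eq_same,
      one_smul]

theorem injective_ofKerAeval_iff (hφ : Pairwise fun s s' => IsCoprime (φ s) (φ s'))
    (v : (s : ι) → Fin (k s) → kerAeval D (φ s)) :
    Function.Injective (ofKerAeval v) ↔ ∀ s, LinearIndependent (AdjoinRoot (φ s)) (v s) := by
  classical
  rw [injective_iff_map_eq_zero]
  simp only [Fintype.linearIndependent_iff]
  constructor
  · intro h s c hc i
    have single_eq_zero := h (Pi.single s c) (by rw [ofKerAeval_single, hc, Submodule.coe_zero])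
    simpa using congrFun (congrFun single_eq_zero s) i
  · intro h x hx
    ext s i
    exact h s (x s) (eq_zero_of_sum_kerAeval hφ (fun s => ∑ i, x s i • v s i) hx s) i

/-- The embeddings of `⨁ s, (K[X] / (φ s)) ^ (k s)` amount to families of linearly independent
vectors in the kernels. -/
def equivariantEmbEquivLinearIndependent [DecidableEq ι]
    (hφ : Pairwise fun s s' => IsCoprime (φ s) (φ s')) :
    equivariantEmb (mulRoot φ k) D ≃ ((s : ι) → {v : Fin (k s) → kerAeval D (φ s) //
      LinearIndependent (AdjoinRoot (φ s)) v}) where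
  toFun g s := ⟨equivariantEquiv ⟨g.1, g.2.2⟩ s, by
    refine (injective_ofKerAeval_iff hφ _).1 ?_ s
    rw [← eq_ofKerAeval g.2.2 fun _ _ => rfl]
    exact g.2.1⟩
  invFun v := ⟨ofKerAeval fun s => (v s).1,
    (injective_ofKerAeval_iff hφ _).2 fun s => (v s).2, ofKerAeval_comp_mulRoot _⟩
  left_inv g := Subtype.ext (eq_ofKerAeval g.2.2 fun _ _ => rfl).symm
  right_inv v := funext fun s => Subtype.ext <|
    congrFun (equivariantEquiv.apply_symm_apply fun s => (v s).1) s

theorem natCard_linearIndependent {L U : Type*} [Field L] [Finite L] [AddCommGroup U] [Module L U]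
    [Finite U] (k : ℕ) : (Nat.card {v : Fin k → U // LinearIndependent L v} : ℝ) =
      ∏ i ∈ Finset.range k, ((Nat.card L : ℝ) ^ Module.finrank L U - (Nat.card L : ℝ) ^ i) := by
  have := Fintype.ofFinite L
  obtain hk | hk := le_or_gt k (Module.finrank L U)
  · rw [card_linearIndependent hk, Nat.cast_prod, Finset.prod_range]
    refine Finset.prod_congr rfl fun i _ => ?_
    rw [Nat.cast_sub (Nat.pow_le_pow_right Fintype.card_pos (i.2.le.trans hk)),
      Nat.card_eq_fintype_card, Nat.cast_pow, Nat.cast_pow]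
  · have := Module.Finite.of_finite (R := L) (M := U)
    have : IsEmpty {v : Fin k → U // LinearIndependent L v} :=
      ⟨fun v => hk.not_ge (by simpa using v.2.fintype_card_le_finrank)⟩
    rw [Finset.prod_eq_zero (Finset.mem_range.2 hk) (sub_self _), Nat.card_of_isEmpty,
      Nat.cast_zero]

theorem ncard_equivariantEmb_mulRoot [Finite K] [Finite N]
    (hφ : Pairwise fun s s' => IsCoprime (φ s) (φ s')) [∀ s, Fact (Irreducible (φ s))] :
    ((equivariantEmb (mulRoot φ k) D).ncard : ℝ) = ∏ s, ∏ i ∈ Finset.range (k s),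
      (((Nat.card K : ℝ) ^ (φ s).natDegree) ^
          Module.finrank (AdjoinRoot (φ s)) (kerAeval D (φ s)) -
        ((Nat.card K : ℝ) ^ (φ s).natDegree) ^ i) := by
  classical
  rw [← Nat.card_coe_set_eq, Nat.card_congr (equivariantEmbEquivLinearIndependent hφ), Nat.card_pi,
    Nat.cast_prod]
  refine Finset.prod_congr rfl fun s _ => ?_
  have hs : φ s ≠ 0 := (Fact.out : Irreducible (φ s)).ne_zero
  have := (AdjoinRoot.powerBasis hs).finite
  have : Finite (AdjoinRoot (φ s)) := Module.finite_of_finite K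
  rw [natCard_linearIndependent, natCard_adjoinRoot hs, Nat.cast_pow]

end CyclicSum

section TildeConj

variable {F K : Type*} [Field F] [Fintype F] [Field K] [Algebra F K]

theorem reverse_reverse_of_coeff_zero_ne_zero {R : Type*} [Semiring R] {f : R[X]}
    (hf : f.coeff 0 ≠ 0) : f.reverse.reverse = f := by
  have natDegree_reverse : f.reverse.natDegree = f.natDegree := by
    rw [reverse_natDegree, natTrailingDegree_eq_zero.2 (Or.inr hf), Nat.sub_zero]
  rw [reverse, natDegree_reverse, reverse, reflect_reflect]

variable {f g : K[X]}

theorem natTrailingDegree_map_conj (h0 : f.coeff 0 ≠ 0) :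
    (f.map (conj F K)).natTrailingDegree = 0 :=
  natTrailingDegree_eq_zero.2 <| Or.inr <| by rwa [coeff_map, Ne, _root_.map_eq_zero]

theorem natDegree_tildeConj (h0 : f.coeff 0 ≠ 0) :
    (tildeConj F K f).natDegree = f.natDegree := by
  rw [tildeConj, natDegree_C_mul (inv_ne_zero ((_root_.map_ne_zero _).2 h0)), reverse_natDegree,
    natTrailingDegree_map_conj h0, natDegree_map, Nat.sub_zero]

theorem monic_tildeConj (h0 : f.coeff 0 ≠ 0) : (tildeConj F K f).Monic := by
  rw [Monic, tildeConj, leadingCoeff_mul, leadingCoeff_C, reverse_leadingCoeff, trailingCoeff,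
    natTrailingDegree_map_conj h0, coeff_map]
  exact inv_mul_cancel₀ ((_root_.map_ne_zero _).2 h0)

theorem coeff_zero_tildeConj (hf : f.Monic) :
    (tildeConj F K f).coeff 0 = (conj F K (f.coeff 0))⁻¹ := by
  rw [tildeConj, coeff_C_mul, coeff_zero_reverse, (hf.map _).leadingCoeff, mul_one]

theorem coeff_zero_tildeConj_ne_zero (hf : f.Monic) (h0 : f.coeff 0 ≠ 0) :
    (tildeConj F K f).coeff 0 ≠ 0 := by
  rw [coeff_zero_tildeConj hf]
  exact inv_ne_zero ((_root_.map_ne_zero _).2 h0)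

theorem tildeConj_mul (f g : K[X]) :
    tildeConj F K (f * g) = tildeConj F K f * tildeConj F K g := by
  simp only [tildeConj, mul_coeff_zero, map_mul, mul_inv, Polynomial.map_mul,
    reverse_mul_of_domain]
  ring

theorem tildeConj_tildeConj (hK : Module.finrank F K = 2) (hf : f.Monic) (h0 : f.coeff 0 ≠ 0) :
    tildeConj F K (tildeConj F K f) = f := by
  have map_reverse_map : (f.map (conj F K)).reverse.map (conj F K) = f.reverse := by
    rw [reverse, reverse, reflect_map, natDegree_map, Polynomial.map_map]
    exact Polynomial.ext fun n => by rw [coeff_map]; exact conj_involutive hK _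
  rw [tildeConj, coeff_zero_tildeConj hf, map_inv₀ (conj F K), inv_inv, conj_involutive hK,
    tildeConj, Polynomial.map_mul, map_C, map_inv₀ (conj F K), conj_involutive hK, map_reverse_map,
    reverse_mul_of_domain, reverse_C, reverse_reverse_of_coeff_zero_ne_zero h0, ← mul_assoc,
    ← C_mul, mul_inv_cancel₀ h0, C_1, one_mul]

theorem isUnit_tildeConj_iff (h0 : f.coeff 0 ≠ 0) : IsUnit (tildeConj F K f) ↔ IsUnit f := by
  rw [isUnit_iff_degree_eq_zero, isUnit_iff_degree_eq_zero,
    degree_eq_natDegree (monic_tildeConj h0).ne_zero, natDegree_tildeConj h0,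
    degree_eq_natDegree (by rintro rfl; simp at h0)]

theorem irreducible_tildeConj (hK : Module.finrank F K = 2) (hf : f.Monic) (h0 : f.coeff 0 ≠ 0)
    (hi : Irreducible f) : Irreducible (tildeConj F K f) := by
  refine ⟨mt (isUnit_tildeConj_iff h0).1 hi.not_isUnit, fun a b hab => ?_⟩
  have f_eq : f = tildeConj F K a * tildeConj F K b := by
    rw [← tildeConj_mul, ← hab, tildeConj_tildeConj hK hf h0]
  have coeff_ne_zero : a.coeff 0 * b.coeff 0 ≠ 0 := by
    rw [← mul_coeff_zero, ← hab]
    exact coeff_zero_tildeConj_ne_zero hf h0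
  rw [← isUnit_tildeConj_iff (F := F) (left_ne_zero_of_mul coeff_ne_zero),
    ← isUnit_tildeConj_iff (F := F) (right_ne_zero_of_mul coeff_ne_zero)]
  exact hi.isUnit_or_isUnit f_eq

theorem root_ne_zero [Fact (Irreducible g)] (h0 : g.coeff 0 ≠ 0) : AdjoinRoot.root g ≠ 0 := by
  intro h
  rw [← AdjoinRoot.mk_X, AdjoinRoot.mk_eq_zero] at h
  exact h0 (X_dvd_iff.1
    ((Fact.out : Irreducible g).associated_of_dvd irreducible_X h).symm.dvd)

theorem aeval_inv_map_conj_eq_zero_iff {L : Type*} [Field L] [Algebra K L] {x : L} (hx : x ≠ 0)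
    (h0 : f.coeff 0 ≠ 0) :
    aeval x⁻¹ (f.map (conj F K)) = 0 ↔ aeval x (tildeConj F K f) = 0 := by
  let _ := invertibleOfNonzero (inv_ne_zero hx)
  have reverse_iff := eval₂_reverse_eq_zero_iff (algebraMap K L) x⁻¹ (f.map (conj F K))
  rw [invOf_eq_inv, inv_inv] at reverse_iff
  rw [aeval_def, ← reverse_iff, tildeConj, map_mul, aeval_C, mul_eq_zero, aeval_def, or_iff_right]
  simpa using h0

theorem odd_finrank_of_mul_self_eq_frobeniusAlgHom {k L : Type*} [Field k] [Fintype k] [Field L]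
    [Finite L] [Algebra k L] {τ : L →ₐ[k] L} (hτ : τ * τ = FiniteField.frobeniusAlgHom k L) :
    Odd (Module.finrank k L) := by
  have order := FiniteField.orderOf_frobeniusAlgHom k L
  have frobenius_pow_eq_one : FiniteField.frobeniusAlgHom k L ^ Module.finrank k L = 1 := by
    rw [← order, pow_orderOf_eq_one]
  obtain ⟨m, hm⟩ := (FiniteField.bijective_frobeniusAlgHom_pow k L).2 τ
  have τ_pow : τ ^ Module.finrank k L = 1 := by
    rw [← hm, ← pow_mul, mul_comm, pow_mul, frobenius_pow_eq_one, one_pow]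
  by_contra even
  obtain ⟨e, he⟩ := Nat.not_odd_iff_even.1 even
  have frobenius_pow_half : FiniteField.frobeniusAlgHom k L ^ e = 1 := by
    rw [← hτ, ← pow_two, ← pow_mul, two_mul, ← he, τ_pow]
  have dvd_half := orderOf_dvd_of_pow_eq_one frobenius_pow_half
  have finrank_pos : 0 < Module.finrank k L := Module.finrank_pos
  have := Nat.le_of_dvd (by omega) dvd_half
  omega

/- If `r` is a root of `f = f̃`, then so is `r ^ (-q)`, and `r ↦ r ^ (-q)` is a square root of the
Frobenius automorphism `r ↦ r ^ (q ^ 2)`. -/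
theorem odd_natDegree_of_eq_tildeConj (hK : Module.finrank F K = 2) (h0 : f.coeff 0 ≠ 0)
    (hi : Irreducible f) (h : f = tildeConj F K f) : Odd f.natDegree := by
  have := finite_of_finrank_eq_two hK
  have := Fintype.ofFinite K
  have : Fact (Irreducible f) := ⟨hi⟩
  have := (AdjoinRoot.powerBasis hi.ne_zero).finite
  have : Finite (AdjoinRoot f) := Module.finite_of_finite K
  set r := AdjoinRoot.root f
  have aeval_inv : aeval r⁻¹ (f.map (conj F K)) = 0 := by
    rw [aeval_inv_map_conj_eq_zero_iff (root_ne_zero h0) h0, ← h, AdjoinRoot.aeval_eq,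
      AdjoinRoot.mk_self]
  have aeval_inv_pow : aeval (r⁻¹ ^ Fintype.card F) f = 0 := by
    have conj_aeval_inv := congrArg (conj F (AdjoinRoot f)) aeval_inv
    rw [map_zero, aeval_def, eval₂_map, hom_eval₂] at conj_aeval_inv
    rw [aeval_def, ← conj_aeval_inv]
    congr 1
    ext c
    rw [RingHom.comp_apply, RingHom.comp_apply, conj_apply, ← map_pow, ← conj_apply F,
      conj_involutive hK]
  let τ : AdjoinRoot f →ₐ[K] AdjoinRoot f :=
    AdjoinRoot.liftAlgHom f (Algebra.ofId K (AdjoinRoot f)) (r⁻¹ ^ Fintype.card F) aeval_inv_pow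
  have τ_root : τ r = r⁻¹ ^ Fintype.card F := AdjoinRoot.liftAlgHom_root ..
  have τ_sq : τ * τ = FiniteField.frobeniusAlgHom K (AdjoinRoot f) := by
    refine AdjoinRoot.algHom_ext ?_
    change τ (τ r) = r ^ Fintype.card K
    rw [τ_root, map_pow, map_inv₀, τ_root, ← Nat.card_eq_fintype_card (α := K), natCard_eq_sq hK,
      ← inv_pow, inv_inv, ← pow_mul, pow_two]
  have odd_finrank := odd_finrank_of_mul_self_eq_frobeniusAlgHom τ_sq
  rwa [(AdjoinRoot.powerBasis hi.ne_zero).finrank, AdjoinRoot.powerBasis_dim] at odd_finrank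

end TildeConj

section CyclicForms

variable {K M : Type*} [Field K] {σ : K →+* K} [AddCommGroup M] [Module K M]

theorem natCard_semilinear [Finite K] (hσ : Function.Involutive σ) [Module.Finite K M] :
    Nat.card (M →ₛₗ[σ] K) = Nat.card K ^ Module.finrank K M := by
  have e : (M →ₛₗ[σ] K) ≃ Module.Dual K M :=
    { toFun := fun l =>
        { toFun := fun x => σ (l x)
          map_add' := fun x y => by rw [map_add, map_add]
          map_smul' := fun c x => by
            rw [map_smulₛₗ, smul_eq_mul, map_mul, hσ, smul_eq_mul, RingHom.id_apply] }
      invFun := fun l =>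
        { toFun := fun x => σ (l x)
          map_add' := fun x y => by rw [map_add, map_add]
          map_smul' := fun c x => by rw [map_smul, smul_eq_mul, map_mul, smul_eq_mul] }
      left_inv := fun l => by ext x; exact hσ _
      right_inv := fun l => by ext x; exact hσ _ }
  rw [Nat.card_congr e, Module.natCard_eq_pow_finrank (K := K), Subspace.dual_finrank_eq]

/-- A form `β` is invariant under `T` if and only if `β(·, T x) = β(T⁻¹ ·, x)`, which makes it an
equivariant map from `(M, T)` to the conjugate-dual of `(M, T⁻¹)`. -/
def invariantFormsEquiv {T S : Module.End K M} (hTS : T * S = 1) (hST : S * T = 1) :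
    invariantForms σ T ≃
      {g : M →ₗ[K] (M →ₛₗ[σ] K) // g ∘ₗ T = LinearMap.lcompₛₗ K K σ S ∘ₗ g} where
  toFun β := ⟨β.1.flip, LinearMap.ext₂ fun x y => by
    have invariant := LinearMap.congr_fun₂ β.2 (S y) x
    rw [pullback_apply, ← Module.End.mul_apply T, hTS] at invariant
    exact invariant⟩
  invFun g := ⟨g.1.flip, LinearMap.ext₂ fun y x => by
    have equivariant := LinearMap.congr_fun₂ g.2 x (T y)
    change _ = g.1 x ((S * T) y) at equivariant
    rw [hST] at equivariant
    exact equivariant⟩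

theorem aeval_lcompₛₗ_apply (hσ : Function.Involutive σ) (S : Module.End K M) (p : K[X])
    (l : M →ₛₗ[σ] K) (x : M) :
    aeval (LinearMap.lcompₛₗ K K σ S : Module.End K (M →ₛₗ[σ] K)) p l x =
      l (aeval S (p.map σ) x) := by
  induction p using Polynomial.induction_on generalizing l with
  | C a => simp [Module.algebraMap_end_apply, hσ a]
  | add p q hp hq =>
    simp only [Polynomial.map_add, map_add, LinearMap.add_apply, hp, hq]
  | monomial n a ih =>
    rw [pow_succ, ← mul_assoc, Polynomial.map_mul, map_mul (aeval _), mul_comm (Polynomial.map σ _),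
      map_mul (aeval S), map_X, aeval_X, aeval_X, Module.End.mul_apply, Module.End.mul_apply, ih,
      LinearMap.lcompₛₗ_apply]

variable {ι : Type*} {φ : ι → K[X]} {k : ι → ℕ} [∀ s, Fact (Irreducible (φ s))]

theorem natCard_semilinear_comp_mulBy_eq_zero {c : (s : ι) → AdjoinRoot (φ s)} {r : ι}
    (hc : ∀ s, c s = 0 ↔ s = r) :
    Nat.card {l : CyclicSum φ k →ₛₗ[σ] K // ∀ x, l (mulBy φ k c x) = 0} =
      Nat.card ((Fin (k r) → AdjoinRoot (φ r)) →ₛₗ[σ] K) := by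
  classical
  refine Nat.card_congr
    { toFun := fun l => l.1.comp (LinearMap.single K (fun s => Fin (k s) → AdjoinRoot (φ s)) r)
      invFun := fun m => ⟨m.comp (LinearMap.proj r : CyclicSum φ k →ₗ[K] _), fun x => ?_⟩
      left_inv := ?_
      right_inv := fun m => LinearMap.ext fun x => by simp }
  · change m (c r • x r) = 0
    rw [(hc r).2 rfl, zero_smul, map_zero]
  · rintro ⟨l, hl⟩
    refine Subtype.ext (LinearMap.ext fun x => ?_)
    have mulBy_eq : mulBy φ k c (fun s i => (c s)⁻¹ * x s i) = x - Pi.single r (x r) := by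
      ext s i
      rw [mulBy_apply, Pi.sub_apply, Pi.sub_apply]
      obtain rfl | hs := eq_or_ne s r
      · rw [(hc s).2 rfl, zero_mul, Pi.single_eq_same, sub_self]
      · rw [Pi.single_eq_of_ne hs, mul_inv_cancel_left₀ (mt (hc s).1 hs), Pi.zero_apply, sub_zero]
    change l (Pi.single r (x r)) = l x
    rw [eq_comm, ← sub_eq_zero, ← map_sub, ← mulBy_eq, hl]

section Conj

variable {F : Type*} [Field F] [Fintype F] [Algebra F K]

theorem natCard_kerAeval_lcompₛₗ (hK : Module.finrank F K = 2) (h0 : ∀ s, (φ s).coeff 0 ≠ 0)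
    (hm : ∀ s, (φ s).Monic) (hφ : Function.Injective φ) {r r' : ι}
    (hr : φ r' = tildeConj F K (φ r)) :
    Nat.card (kerAeval (LinearMap.lcompₛₗ K K (conj F K)
      (mulBy φ k fun s => (AdjoinRoot.root (φ s))⁻¹)) (φ r)) =
      Nat.card K ^ (k r' * (φ r').natDegree) := by
  have aeval_eq_zero_iff (s : ι) :
      aeval (AdjoinRoot.root (φ s))⁻¹ ((φ r).map (conj F K)) = 0 ↔ s = r' := by
    rw [aeval_inv_map_conj_eq_zero_iff (root_ne_zero (h0 s)) (h0 r), ← hr, AdjoinRoot.aeval_eq,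
      AdjoinRoot.mk_eq_zero]
    refine ⟨fun h => hφ (eq_of_monic_of_associated (hm s) (hm r') ?_), by rintro rfl; rfl⟩
    exact (Fact.out : Irreducible (φ s)).associated_of_dvd Fact.out h
  have mem_kerAeval_iff (l : CyclicSum φ k →ₛₗ[conj F K] K) :
      l ∈ kerAeval (LinearMap.lcompₛₗ K K (conj F K)
        (mulBy φ k fun s => (AdjoinRoot.root (φ s))⁻¹)) (φ r) ↔ ∀ x, l (mulBy φ k
        (fun s => aeval (AdjoinRoot.root (φ s))⁻¹ ((φ r).map (conj F K))) x) = 0 := by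
    rw [LinearMap.mem_ker, LinearMap.ext_iff]
    simp only [aeval_lcompₛₗ_apply (conj_involutive hK), aeval_mulBy, LinearMap.zero_apply]
  have hr' : φ r' ≠ 0 := (Fact.out : Irreducible (φ r')).ne_zero
  have := finite_of_finrank_eq_two hK
  have := (AdjoinRoot.powerBasis hr').finite
  rw [Nat.card_congr (Equiv.subtypeEquivRight mem_kerAeval_iff),
    natCard_semilinear_comp_mulBy_eq_zero aeval_eq_zero_iff,
    natCard_semilinear (conj_involutive hK), Module.finrank_pi_fintype, Finset.sum_const,
    Finset.card_univ, Fintype.card_fin, smul_eq_mul, (AdjoinRoot.powerBasis hr').finrank,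
    AdjoinRoot.powerBasis_dim]

variable [Fintype ι]

theorem ncard_invariantForms_mulRoot (hK : Module.finrank F K = 2) (h0 : ∀ s, (φ s).coeff 0 ≠ 0)
    (hm : ∀ s, (φ s).Monic) (hφ : Function.Injective φ) {τ : ι → ι}
    (hτ : ∀ r, φ (τ r) = tildeConj F K (φ r)) :
    (invariantForms (conj F K) (mulRoot φ k)).ncard =
      ∏ r, (Nat.card K ^ (k (τ r) * (φ (τ r)).natDegree)) ^ k r := by
  have root_mul_inv : mulRoot φ k * mulBy φ k (fun s => (AdjoinRoot.root (φ s))⁻¹) = 1 := by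
    refine LinearMap.ext fun x => funext₂ fun s i => ?_
    exact mul_inv_cancel_left₀ (root_ne_zero (h0 s)) _
  have inv_mul_root : mulBy φ k (fun s => (AdjoinRoot.root (φ s))⁻¹) * mulRoot φ k = 1 := by
    refine LinearMap.ext fun x => funext₂ fun s i => ?_
    exact inv_mul_cancel_left₀ (root_ne_zero (h0 s)) _
  classical
  rw [← Nat.card_coe_set_eq,
    Nat.card_congr ((invariantFormsEquiv root_mul_inv inv_mul_root).trans equivariantEquiv),
    Nat.card_pi]
  refine Finset.prod_congr rfl fun r _ => ?_
  rw [Nat.card_pi, Finset.prod_const, Finset.card_univ, Fintype.card_fin,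
    natCard_kerAeval_lcompₛₗ hK h0 hm hφ (hτ r)]

theorem ncard_invariantHermitianForms_mulRoot (hK : Module.finrank F K = 2)
    (h0 : ∀ s, (φ s).coeff 0 ≠ 0) (hm : ∀ s, (φ s).Monic) (hφ : Function.Injective φ) {τ : ι → ι}
    (hτ : ∀ r, φ (τ r) = tildeConj F K (φ r)) :
    (invariantHermitianForms (conj F K) (mulRoot φ k)).ncard =
      ∏ r, Fintype.card F ^ ((φ (τ r)).natDegree * k r * k (τ r)) := by
  refine (Nat.pow_left_injective two_ne_zero).eq_iff.1 ?_
  rw [ncard_invariantHermitianForms_sq (conj_involutive hK) (conj_ne_id hK),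
    ncard_invariantForms_mulRoot hK h0 hm hφ hτ, ← Finset.prod_pow]
  refine Finset.prod_congr rfl fun r _ => ?_
  rw [natCard_eq_sq hK]
  ring

end Conj

end CyclicForms

section CharacteristicPolynomial

variable {K : Type*} [Field K] {n : ℕ} (A : Matrix (Fin n) (Fin n) K) {f : K[X]}

theorem aeval_toLin' (f : K[X]) :
    aeval (Matrix.toLin' A : Module.End K (Fin n → K)) f = Matrix.toLin' (aeval A f) :=
  aeval_algHom_apply (Matrix.toLinAlgEquiv' (R := K) (n := Fin n)) A f

theorem det_aeval_eq_zero_of_dvd_charpoly (hf : Irreducible f) (hdvd : f ∣ A.charpoly) :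
    (aeval A f).det = 0 := by
  have : Fact (Irreducible f) := ⟨hf⟩
  let ι := algebraMap K (AdjoinRoot f)
  have hroot : IsRoot (A.map ι).charpoly (AdjoinRoot.root f) := by
    rw [Matrix.charpoly_map, IsRoot.def, eval_map_algebraMap, AdjoinRoot.aeval_eq]
    exact AdjoinRoot.mk_eq_zero.2 hdvd
  have hspec : eval (AdjoinRoot.root f) (f.map ι) ∈ spectrum _ (aeval (A.map ι) (f.map ι)) :=
    spectrum.subset_polynomial_aeval _ _ ⟨_, Matrix.mem_spectrum_of_isRoot_charpoly hroot, rfl⟩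
  have hmap : aeval (A.map ι) (f.map ι) = (aeval A f).map ι := by
    rw [aeval_map_algebraMap]
    exact aeval_algHom_apply (Algebra.ofId K (AdjoinRoot f)).mapMatrix A f
  rw [eval_map_algebraMap, AdjoinRoot.aeval_eq, AdjoinRoot.mk_self, hmap, spectrum.zero_mem_iff,
    Matrix.isUnit_iff_isUnit_det, ← RingHom.mapMatrix_apply, ← RingHom.map_det, isUnit_iff_ne_zero,
    not_not] at hspec
  exact (map_eq_zero ι).1 hspec

theorem dvd_charpoly_iff_kerAeval_ne_bot (hf : Irreducible f) :
    f ∣ A.charpoly ↔ kerAeval (Matrix.toLin' A) f ≠ ⊥ := by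
  refine ⟨fun hdvd hbot => ?_, fun hbot => by_contra fun hdvd => hbot ?_⟩
  · obtain ⟨v, hv, hv0⟩ :=
      Matrix.exists_mulVec_eq_zero_iff.2 (det_aeval_eq_zero_of_dvd_charpoly A hf hdvd)
    refine hv ((Submodule.eq_bot_iff _).1 hbot v ?_)
    rwa [LinearMap.mem_ker, aeval_toLin', Matrix.toLin'_apply]
  · have hdisj := disjoint_ker_aeval_of_isCoprime (Matrix.toLin' A : Module.End K (Fin n → K))
      (hf.coprime_iff_not_dvd.2 hdvd)
    rwa [aeval_toLin', aeval_toLin', Matrix.aeval_self_charpoly, map_zero, LinearMap.ker_zero,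
      disjoint_top, ← aeval_toLin'] at hdisj

end CharacteristicPolynomial

section SmallPolynomials

variable {F K : Type*} [Field F] [Fintype F] [Field K] [Algebra F K] {t n : ℕ}

/-- A monic irreducible polynomial over `K` of degree at most `t`, other than `X`. -/
@[ext]
structure SmallPoly (K : Type*) [Field K] (t : ℕ) where
  poly : K[X]
  monic : poly.Monic
  irreducible : Irreducible poly
  natDegree_le : poly.natDegree ≤ t
  coeff_zero_ne_zero : poly.coeff 0 ≠ 0

instance (s : SmallPoly K t) : Fact (Irreducible s.poly) := ⟨s.irreducible⟩

theorem finite_smallPoly [Finite K] : Finite (SmallPoly K t) := by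
  refine Finite.of_injective (fun (s : SmallPoly K t) (i : Fin (t + 1)) => s.poly.coeff i) ?_
  intro s s' h
  refine SmallPoly.ext (Polynomial.ext fun i => ?_)
  rcases lt_or_ge i (t + 1) with hi | hi
  · exact congrFun h ⟨i, hi⟩
  · rw [coeff_eq_zero_of_natDegree_lt (s.natDegree_le.trans_lt hi),
      coeff_eq_zero_of_natDegree_lt (s'.natDegree_le.trans_lt hi)]

theorem SmallPoly.natDegree_pos (s : SmallPoly K t) : 0 < s.poly.natDegree :=
  s.irreducible.natDegree_pos

theorem SmallPoly.pairwise_isCoprime :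
    Pairwise fun s s' : SmallPoly K t => IsCoprime s.poly s'.poly := by
  intro s s' h
  refine s.irreducible.coprime_iff_not_dvd.2 fun hdvd => h (SmallPoly.ext ?_)
  exact eq_of_monic_of_associated s.monic s'.monic
    (s.irreducible.associated_of_dvd s'.irreducible hdvd)

/-- The involution `φ ↦ φ̃` on small polynomials. -/
def SmallPoly.tilde (hK : Module.finrank F K = 2) (s : SmallPoly K t) : SmallPoly K t where
  poly := tildeConj F K s.poly
  monic := monic_tildeConj s.coeff_zero_ne_zero
  irreducible := irreducible_tildeConj hK s.monic s.coeff_zero_ne_zero s.irreducible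
  natDegree_le := (natDegree_tildeConj s.coeff_zero_ne_zero).trans_le s.natDegree_le
  coeff_zero_ne_zero := coeff_zero_tildeConj_ne_zero s.monic s.coeff_zero_ne_zero

theorem SmallPoly.tilde_involutive (hK : Module.finrank F K = 2) :
    Function.Involutive (SmallPoly.tilde (t := t) hK) := fun s =>
  SmallPoly.ext (tildeConj_tildeConj hK s.monic s.coeff_zero_ne_zero)

theorem SmallPoly.natDegree_tilde (hK : Module.finrank F K = 2) (s : SmallPoly K t) :
    (s.tilde hK).poly.natDegree = s.poly.natDegree :=
  natDegree_tildeConj s.coeff_zero_ne_zero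

theorem exists_smallPoly_dvd {A : Matrix (Fin n) (Fin n) K} (hA : A.det ≠ 0) {f : K[X]}
    (hf : Irreducible f) (hdeg : f.natDegree ≤ t) (hdvd : f ∣ A.charpoly) :
    ∃ s : SmallPoly K t, s.poly ∣ A.charpoly := by
  classical
  have hassoc := associated_normalize f
  have hdvd' : normalize f ∣ A.charpoly := hassoc.symm.dvd.trans hdvd
  refine ⟨⟨normalize f, monic_normalize hf.ne_zero, hassoc.irreducible hf, ?_, fun h0 => hA ?_⟩,
    hdvd'⟩
  · rwa [natDegree_eq_of_degree_eq (degree_eq_degree_of_associated hassoc.symm)]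
  · rw [Matrix.det_eq_sign_charpoly_coeff, X_dvd_iff.1 ((X_dvd_iff.2 h0).trans hdvd'), mul_zero]

theorem noSmallFactor_iff {A : Matrix (Fin n) (Fin n) K} (hA : A.det ≠ 0) :
    NoSmallFactor t A ↔ ∀ s : SmallPoly K t,
      Module.finrank (AdjoinRoot s.poly) (kerAeval (Matrix.toLin' A) s.poly) = 0 := by
  have hker (s : SmallPoly K t) :
      Module.finrank (AdjoinRoot s.poly) (kerAeval (Matrix.toLin' A) s.poly) = 0 ↔
        ¬ s.poly ∣ A.charpoly := by
    have : Module.Finite (AdjoinRoot s.poly) (kerAeval (Matrix.toLin' A) s.poly) :=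
      Module.Finite.of_restrictScalars_finite K _ _
    rw [Module.finrank_eq_zero_iff_of_free, Submodule.subsingleton_iff_eq_bot,
      dvd_charpoly_iff_kerAeval_ne_bot A s.irreducible, not_not]
  simp only [hker]
  refine ⟨fun h s hs => (h s.poly s.irreducible hs).not_ge s.natDegree_le, fun h f hf hdvd => ?_⟩
  by_contra! hdeg
  obtain ⟨s, hs⟩ := exists_smallPoly_dvd hA hf hdeg hdvd
  exact h s hs

end SmallPolynomials

section QSeries

theorem summable_norm_of_succ_eq_mul {a ratio : ℕ → ℝ} {l : ℝ}
    (ha : ∀ k, a (k + 1) = ratio k * a k) (hratio : Tendsto ratio atTop (𝓝 l)) (hl : |l| < 1) :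
    Summable fun k => ‖a k‖ := by
  obtain ⟨r, hlr, hr⟩ := exists_between hl
  refine summable_of_ratio_norm_eventually_le hr ?_
  filter_upwards [hratio.abs.eventually_lt_const hlr] with k hk
  rw [norm_norm, norm_norm, ha, norm_mul, Real.norm_eq_abs (ratio k)]
  exact mul_le_mul_of_nonneg_right hk.le (norm_nonneg _)

theorem tendsto_tsum_mul_pow {a : ℕ → ℝ} (ha : Summable fun k => ‖a k‖) {r : ℝ} (hr0 : 0 ≤ r)
    (hr1 : r < 1) : Tendsto (fun N : ℕ => ∑' k, a k * (r ^ N) ^ k) atTop (𝓝 (a 0)) := by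
  have h : Tendsto (fun N : ℕ => ∑' k, a k * (r ^ N) ^ k) atTop
      (𝓝 (∑' k, if k = 0 then a 0 else 0)) := by
    refine tendsto_tsum_of_dominated_convergence ha (fun k => ?_)
      (Eventually.of_forall fun N k => ?_)
    · rcases k with _ | k
      · simp
      · have hpow := (tendsto_pow_atTop_nhds_zero_of_lt_one (pow_nonneg hr0 (k + 1))
          (pow_lt_one₀ hr0 hr1 k.succ_ne_zero)).const_mul (a (k + 1))
        simpa [← pow_mul, mul_comm] using hpow
    · rw [norm_mul, norm_pow, norm_pow, Real.norm_of_nonneg hr0, ← pow_mul]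
      exact mul_le_of_le_one_right (norm_nonneg _) (pow_le_one₀ hr0 hr1.le)
  rwa [tsum_ite_eq] at h

theorem tsum_sub_tsum_mul_pow {a : ℕ → ℝ} {r z : ℝ} (hz : Summable fun k => a k * z ^ k)
    (hrz : Summable fun k => a k * (r * z) ^ k) :
    ∑' k, a k * z ^ k - ∑' k, a k * (r * z) ^ k =
      z * ∑' k, a (k + 1) * (1 - r ^ (k + 1)) * z ^ k := by
  rw [← hz.tsum_sub hrz, (hz.sub hrz).tsum_eq_zero_add, ← tsum_mul_left]
  simp only [pow_zero, sub_self, zero_add, mul_pow]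
  exact tsum_congr fun k => by ring

theorem multipliable_one_add_mul_pow {r : ℝ} (hr : |r| < 1) (c : ℝ) :
    Multipliable fun i : ℕ => 1 + c * r ^ i :=
  Real.multipliable_one_add_of_summable ((summable_geometric_of_abs_lt_one hr).mul_left c)

theorem multipliable_one_add_pow_succ {r : ℝ} (hr : |r| < 1) :
    Multipliable fun i : ℕ => 1 + r ^ (i + 1) := by
  simpa only [← pow_succ'] using multipliable_one_add_mul_pow hr r

theorem multipliable_one_sub_pow_succ {r : ℝ} (hr : |r| < 1) :
    Multipliable fun i : ℕ => 1 - r ^ (i + 1) := by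
  simpa only [neg_mul, ← sub_eq_add_neg, ← pow_succ'] using multipliable_one_add_mul_pow hr (-r)

theorem multipliable_one_sub_pow_odd {r : ℝ} (hr : |r| < 1) :
    Multipliable fun i : ℕ => 1 - r ^ (2 * i + 1) := by
  have hsq : |r ^ 2| < 1 := by rw [abs_pow]; exact pow_lt_one₀ (abs_nonneg r) hr two_ne_zero
  simpa only [neg_mul, ← sub_eq_add_neg, ← pow_mul, ← pow_succ'] using
    multipliable_one_add_mul_pow hsq (-r)

theorem tprod_one_sub_pow_succ_ne_zero {r : ℝ} (hr : |r| < 1) :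
    ∏' i : ℕ, (1 - r ^ (i + 1)) ≠ 0 := by
  have hsum : Summable fun i : ℕ => ‖-r ^ (i + 1)‖ := by
    simpa only [norm_neg] using
      ((summable_nat_add_iff 1).2 (summable_geometric_of_abs_lt_one hr)).norm
  simp only [sub_eq_add_neg]
  refine tprod_one_add_ne_zero_of_summable (fun i h => ?_) hsum
  have hlt : |r ^ (i + 1)| < 1 := by
    rw [abs_pow]
    exact pow_lt_one₀ (abs_nonneg r) hr i.succ_ne_zero
  linarith [(abs_lt.1 hlt).2]

/-- Euler's identity between partitions into distinct parts and into odd parts. -/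
theorem tprod_one_sub_pow_odd_mul_tprod_one_add_pow_succ {r : ℝ} (hr : |r| < 1) :
    (∏' i : ℕ, (1 - r ^ (2 * i + 1))) * ∏' i : ℕ, (1 + r ^ (i + 1)) = 1 := by
  have hsq : |r ^ 2| < 1 := by rw [abs_pow]; exact pow_lt_one₀ (abs_nonneg r) hr two_ne_zero
  have heven (i : ℕ) : (r ^ 2) ^ (i + 1) = r ^ (2 * i + 1 + 1) := (pow_mul r 2 (i + 1)).symm
  have hsplit : (∏' i : ℕ, (1 - r ^ (2 * i + 1))) * ∏' i : ℕ, (1 - (r ^ 2) ^ (i + 1)) =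
      ∏' i : ℕ, (1 - r ^ (i + 1)) := by
    simp only [heven]
    refine tprod_even_mul_odd (f := fun i => 1 - r ^ (i + 1)) (multipliable_one_sub_pow_odd hr) ?_
    simpa only [heven] using multipliable_one_sub_pow_succ hsq
  have hfactor : (∏' i : ℕ, (1 - r ^ (i + 1))) * ∏' i : ℕ, (1 + r ^ (i + 1)) =
      ∏' i : ℕ, (1 - (r ^ 2) ^ (i + 1)) := by
    rw [← (multipliable_one_sub_pow_succ hr).tprod_mul (multipliable_one_add_pow_succ hr)]
    exact tprod_congr fun i => by ring
  refine mul_left_cancel₀ (tprod_one_sub_pow_succ_ne_zero hsq) ?_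
  linear_combination (∏' i : ℕ, (1 + r ^ (i + 1))) * hsplit + hfactor

/-- The coefficients of the inclusion-exclusion formula over a field with `X` elements: the sum of
`coef X k` times the number `∏ i < k, (X ^ w - X ^ i)` of injective linear maps from a
`k`-dimensional space to a `w`-dimensional one detects whether `w = 0`. -/
def coef (X : ℝ) (k : ℕ) : ℝ := (-1) ^ k / ∏ i ∈ Finset.range k, (X ^ (i + 1) - 1)

theorem coef_zero (X : ℝ) : coef X 0 = 1 := by simp [coef]

theorem coef_succ (X : ℝ) (k : ℕ) : coef X (k + 1) = -(X ^ (k + 1) - 1)⁻¹ * coef X k := by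
  rw [coef, coef, Finset.prod_range_succ, pow_succ, ← div_div]
  ring

variable {X : ℝ} (hX : 1 < X)
include hX

theorem pow_succ_sub_one_ne_zero (i : ℕ) : X ^ (i + 1) - 1 ≠ 0 :=
  (sub_pos.2 (one_lt_pow₀ hX i.succ_ne_zero)).ne'

theorem coef_succ_mul (k : ℕ) : coef X (k + 1) * (1 - X ^ (k + 1)) = coef X k := by
  have h := pow_succ_sub_one_ne_zero hX k
  rw [coef_succ]
  field_simp
  ring

theorem sum_coef_mul_prod (Y : ℝ) (N : ℕ) :
    ∑ k ∈ Finset.range (N + 1), coef X k * ∏ i ∈ Finset.range k, (Y - X ^ i) =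
      coef X N * ∏ i ∈ Finset.range N, (Y - X ^ (i + 1)) := by
  induction N with
  | zero => simp
  | succ N ih =>
    rw [Finset.sum_range_succ, ih, ← coef_succ_mul hX N,
      Finset.prod_range_succ' (fun i => Y - X ^ i),
      Finset.prod_range_succ (fun i => Y - X ^ (i + 1)) N]
    ring

theorem hasSum_coef_mul_prod (w : ℕ) :
    HasSum (fun k => coef X k * ∏ i ∈ Finset.range k, (X ^ w - X ^ i))
      (if w = 0 then 1 else 0) := by
  have hsum : ∑ k ∈ Finset.range (w + 1), coef X k * ∏ i ∈ Finset.range k, (X ^ w - X ^ i) =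
      if w = 0 then 1 else 0 := by
    rw [sum_coef_mul_prod hX]
    rcases w with _ | w
    · simp [coef_zero]
    · rw [if_neg w.succ_ne_zero, Finset.prod_eq_zero (Finset.self_mem_range_succ w) (sub_self _),
        mul_zero]
  rw [← hsum]
  refine hasSum_sum_of_ne_finset_zero fun k hk => ?_
  have hw : w ∈ Finset.range k := Finset.mem_range.2 (by simpa using hk)
  rw [Finset.prod_eq_zero hw (sub_self _), mul_zero]

theorem summable_coef_mul_pow (z : ℝ) : Summable fun k => ‖coef X k * z ^ k‖ := by
  refine summable_norm_of_succ_eq_mul (ratio := fun k => -(X ^ (k + 1) - 1)⁻¹ * z) (l := -0 * z)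
    (fun k => by rw [coef_succ, pow_succ]; ring) ?_ (by simp)
  refine ((tendsto_inv_atTop_zero.comp ?_).neg).mul_const z
  exact tendsto_atTop_add_const_right _ (-1)
    ((tendsto_pow_atTop_atTop_of_one_lt hX).comp (tendsto_add_atTop_nat 1))

theorem tsum_coef_mul_mul_pow (z : ℝ) :
    ∑' k, coef X k * (X * z) ^ k = (1 - z) * ∑' k, coef X k * z ^ k := by
  have h := tsum_sub_tsum_mul_pow (summable_coef_mul_pow hX z).of_norm
    (summable_coef_mul_pow hX (X * z)).of_norm
  simp only [coef_succ_mul hX] at h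
  linear_combination -h

theorem tsum_coef_mul_pow_pow_succ (n : ℕ) : ∑' k, coef X k * (X ^ (n + 1)) ^ k = 0 := by
  induction n with
  | zero => simpa using tsum_coef_mul_mul_pow hX 1
  | succ n ih => rw [pow_succ' X, tsum_coef_mul_mul_pow hX, ih, mul_zero]

theorem abs_inv_lt_one : |X⁻¹| < 1 := by
  rw [abs_inv, abs_of_pos (by positivity)]
  exact inv_lt_one_of_one_lt₀ hX

theorem tsum_coef : ∑' k, coef X k = ∏' i : ℕ, (1 - X⁻¹ ^ (i + 1)) := by
  have hX0 : X ≠ 0 := by positivity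
  have hpartial (N : ℕ) : ∑' k, coef X k =
      (∏ i ∈ Finset.range N, (1 - X⁻¹ ^ (i + 1))) * ∑' k, coef X k * (X⁻¹ ^ N) ^ k := by
    induction N with
    | zero => simp
    | succ N ih =>
      rw [ih, Finset.prod_range_succ, mul_assoc, ← tsum_coef_mul_mul_pow hX, pow_succ',
        mul_inv_cancel_left₀ hX0]
  have hseries : Tendsto (fun N : ℕ => ∑' k, coef X k * (X⁻¹ ^ N) ^ k) atTop (𝓝 1) := by
    rw [← coef_zero X]
    exact tendsto_tsum_mul_pow (by simpa using summable_coef_mul_pow hX 1)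
      (by positivity) (inv_lt_one_of_one_lt₀ hX)
  have hprod := (multipliable_one_sub_pow_succ (abs_inv_lt_one hX)).hasProd.tendsto_prod_nat
  have hlim := hprod.mul hseries
  rw [mul_one] at hlim
  exact tendsto_nhds_unique (tendsto_const_nhds.congr hpartial) hlim

end QSeries

section SelfCoef

/-- The summands of the series attached to a self-conjugate polynomial of degree `d`, where
`b = q ^ d`. -/
def selfCoef (b : ℝ) (k : ℕ) : ℝ := coef (b ^ 2) k * b ^ (k ^ 2)

theorem selfCoef_zero (b : ℝ) : selfCoef b 0 = 1 := by simp [selfCoef, coef_zero]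

variable {b : ℝ} (hb : 1 < b)
include hb

theorem selfCoef_succ_mul (k : ℕ) :
    selfCoef b (k + 1) * (1 - (b⁻¹ ^ 2) ^ (k + 1)) = -b⁻¹ * selfCoef b k := by
  have hb0 : b ≠ 0 := by positivity
  have hX0 : (b ^ 2) ^ (k + 1) ≠ 0 := by positivity
  have hpow : b ^ ((k + 1) ^ 2) * b = b ^ (k ^ 2) * (b ^ 2) ^ (k + 1) := by
    rw [← pow_mul, ← pow_succ, ← pow_add]
    congr 1
    ring
  rw [selfCoef, selfCoef, ← coef_succ_mul (one_lt_pow₀ hb two_ne_zero) k, inv_pow, inv_pow]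
  field_simp
  linear_combination (coef (b ^ 2) (k + 1) * ((b ^ 2) ^ (k + 1) - 1)) * hpow

theorem inv_sq_lt_one : b⁻¹ ^ 2 < 1 :=
  pow_lt_one₀ (by positivity) (inv_lt_one_of_one_lt₀ hb) two_ne_zero

theorem summable_selfCoef : Summable fun k => ‖selfCoef b k‖ := by
  have hne (k : ℕ) : 1 - (b⁻¹ ^ 2) ^ (k + 1) ≠ 0 :=
    (sub_pos.2 (pow_lt_one₀ (sq_nonneg _) (inv_sq_lt_one hb) k.succ_ne_zero)).ne'
  refine summable_norm_of_succ_eq_mul (ratio := fun k => -b⁻¹ / (1 - (b⁻¹ ^ 2) ^ (k + 1)))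
    (l := -b⁻¹ / (1 - 0)) (fun k => ?_) ?_ ?_
  · rw [div_mul_eq_mul_div, eq_div_iff (hne k), selfCoef_succ_mul hb]
  · refine tendsto_const_nhds.div (tendsto_const_nhds.sub ?_) (by norm_num)
    exact (tendsto_pow_atTop_nhds_zero_of_lt_one (sq_nonneg _) (inv_sq_lt_one hb)).comp
      (tendsto_add_atTop_nat 1)
  · rw [sub_zero, div_one, abs_neg]
    exact abs_inv_lt_one hb

theorem summable_selfCoef_mul_pow {z : ℝ} (hz0 : 0 ≤ z) (hz1 : z ≤ 1) :
    Summable fun k => selfCoef b k * z ^ k := by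
  refine Summable.of_norm_bounded (summable_selfCoef hb) fun k => ?_
  rw [norm_mul, norm_pow, Real.norm_of_nonneg hz0]
  exact mul_le_of_le_one_right (norm_nonneg _) (pow_le_one₀ hz0 hz1)

theorem tsum_selfCoef_mul_mul_pow {z : ℝ} (hz0 : 0 ≤ z) (hz1 : z ≤ 1) :
    ∑' k, selfCoef b k * (b⁻¹ ^ 2 * z) ^ k = (1 + b⁻¹ * z) * ∑' k, selfCoef b k * z ^ k := by
  have h := tsum_sub_tsum_mul_pow (r := b⁻¹ ^ 2) (summable_selfCoef_mul_pow hb hz0 hz1)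
    (summable_selfCoef_mul_pow hb (by positivity) (mul_le_one₀ (inv_sq_lt_one hb).le hz0 hz1))
  simp only [selfCoef_succ_mul hb, mul_assoc (-b⁻¹), tsum_mul_left] at h
  linear_combination -h

theorem tprod_odd_mul_tsum_selfCoef :
    (∏' i : ℕ, (1 - (-b⁻¹) ^ (2 * i + 1))) * ∑' k, selfCoef b k = 1 := by
  have hpartial (N : ℕ) :
      (∏ i ∈ Finset.range N, (1 - (-b⁻¹) ^ (2 * i + 1))) * ∑' k, selfCoef b k =
        ∑' k, selfCoef b k * ((b⁻¹ ^ 2) ^ N) ^ k := by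
    induction N with
    | zero => simp
    | succ N ih =>
      rw [Finset.prod_range_succ, mul_right_comm, ih, pow_succ' (b⁻¹ ^ 2),
        tsum_selfCoef_mul_mul_pow hb (by positivity)
          (pow_le_one₀ (sq_nonneg _) (inv_sq_lt_one hb).le), Odd.neg_pow ⟨N, rfl⟩]
      ring
  have hseries : Tendsto (fun N : ℕ => ∑' k, selfCoef b k * ((b⁻¹ ^ 2) ^ N) ^ k) atTop (𝓝 1) := by
    rw [← selfCoef_zero b]
    exact tendsto_tsum_mul_pow (summable_selfCoef hb) (sq_nonneg _) (inv_sq_lt_one hb)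
  have hprod := (multipliable_one_sub_pow_odd
    (by rw [abs_neg]; exact abs_inv_lt_one hb : |-b⁻¹| < 1)).hasProd.tendsto_prod_nat
  exact tendsto_nhds_unique (hprod.mul_const _) (hseries.congr fun N => (hpartial N).symm)

theorem tsum_selfCoef : ∑' k, selfCoef b k = ∏' i : ℕ, (1 + (-b⁻¹) ^ (i + 1)) := by
  have hr : |-b⁻¹| < 1 := by rw [abs_neg]; exact abs_inv_lt_one hb
  have hodd := tprod_odd_mul_tsum_selfCoef hb
  refine mul_left_cancel₀ (left_ne_zero_of_mul_eq_one hodd) ?_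
  rw [hodd, tprod_one_sub_pow_odd_mul_tprod_one_add_pow_succ hr]

end SelfCoef

section SumsOverFunctions

theorem summable_norm_and_tsum_prod_apply_fin {β : Type*} (n : ℕ) (f : Fin n → β → ℝ)
    (hf : ∀ s, Summable fun x => ‖f s x‖) :
    (Summable fun k : Fin n → β => ‖∏ s, f s (k s)‖) ∧
      ∑' k : Fin n → β, ∏ s, f s (k s) = ∏ s, ∑' x, f s x := by
  induction n with
  | zero => exact ⟨Summable.of_finite, by simp [tsum_fintype]⟩
  | succ n ih =>
    obtain ⟨hsummable, htsum⟩ := ih (fun s => f s.succ) fun s => hf s.succ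
    let e : β × (Fin n → β) ≃ (Fin (n + 1) → β) := Fin.consEquiv fun _ => β
    have hcons (p : β × (Fin n → β)) :
        ∏ s, f s (e p s) = f 0 p.1 * ∏ s : Fin n, f s.succ (p.2 s) := Fin.prod_univ_succ _
    constructor
    · rw [← e.summable_iff]
      exact ((hf 0).mul_norm hsummable).congr fun p => by rw [Function.comp_apply, hcons]
    · rw [← e.tsum_eq, Fin.prod_univ_succ, ← htsum, tsum_mul_tsum_of_summable_norm (hf 0) hsummable]
      exact tsum_congr hcons

theorem summable_norm_and_tsum_prod_apply {ι β : Type*} [Fintype ι] (f : ι → β → ℝ)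
    (hf : ∀ s, Summable fun x => ‖f s x‖) :
    (Summable fun k : ι → β => ‖∏ s, f s (k s)‖) ∧
      ∑' k : ι → β, ∏ s, f s (k s) = ∏ s, ∑' x, f s x := by
  let e := Fintype.equivFin ι
  let eFun : (ι → β) ≃ (Fin (Fintype.card ι) → β) := e.arrowCongr (Equiv.refl β)
  have hprod (k : ι → β) : ∏ i, f (e.symm i) (eFun k i) = ∏ s, f s (k s) :=
    e.symm.prod_comp fun s => f s (k s)
  obtain ⟨hsummable, htsum⟩ :=
    summable_norm_and_tsum_prod_apply_fin _ (fun i => f (e.symm i)) fun i => hf _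
  constructor
  · rw [← eFun.summable_iff] at hsummable
    exact hsummable.congr fun k => by rw [Function.comp_apply, hprod]
  · rw [← eFun.tsum_eq, tsum_congr hprod] at htsum
    rw [htsum]
    exact e.symm.prod_comp fun s => ∑' x, f s x

end SumsOverFunctions

section InvolutionOrbits

variable {ι β : Type*} [LinearOrder ι] {τ : ι → ι}

/-- The decomposition of a linearly ordered type into the fixed points of an involution, the smaller
and the larger elements of the two-element orbits, both of the latter indexed by the smaller one. -/
def involutionOrbitEquiv (hτ : Function.Involutive τ) :
    {s // τ s = s} ⊕ ({s // s < τ s} ⊕ {s // s < τ s}) ≃ ι where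
  toFun := Sum.elim (·.1) (Sum.elim (·.1) (τ ·.1))
  invFun s :=
    if hfix : τ s = s then .inl ⟨s, hfix⟩
    else if hlt : s < τ s then .inr (.inl ⟨s, hlt⟩)
    else .inr (.inr ⟨τ s, by rw [hτ s]; exact (le_of_not_gt hlt).lt_of_ne hfix⟩)
  left_inv := by
    rintro (⟨s, hs⟩ | ⟨s, hs⟩ | ⟨s, hs⟩)
    · simp [hs]
    · simp [hs, hs.ne']
    · simp [hτ s, hs.ne, hs.not_gt]
  right_inv s := by
    dsimp only
    split_ifs
    · rfl
    · rfl
    · exact hτ s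

theorem prod_eq_prod_fixed_mul_prod_lt {M : Type*} [CommMonoid M] [Fintype ι]
    (hτ : Function.Involutive τ) (f : ι → M) :
    ∏ s, f s = (∏ s : {s // τ s = s}, f s) * ∏ s : {s // s < τ s}, f s * f (τ s) := by
  rw [← (involutionOrbitEquiv hτ).prod_comp, Fintype.prod_sum_type, Fintype.prod_sum_type,
    ← Finset.prod_mul_distrib]
  rfl

/-- A function is determined by its values on the fixed points of an involution and its pairs of
values on the two-element orbits. -/
def involutionArrowEquiv (hτ : Function.Involutive τ) :
    (ι → β) ≃ ({s // τ s = s} → β) × ({s // s < τ s} → β × β) :=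
  ((involutionOrbitEquiv hτ).arrowCongr (Equiv.refl β)).symm.trans <|
    (Equiv.sumArrowEquivProdArrow _ _ _).trans <|
      (Equiv.refl _).prodCongr <|
        (Equiv.sumArrowEquivProdArrow _ _ _).trans (Equiv.arrowProdEquivProdArrow _ _ _).symm

theorem tsum_prod_involution [Fintype ι] (hτ : Function.Involutive τ) (W : ι → β → β → ℝ)
    (hfixed : ∀ s, τ s = s → Summable fun x => ‖W s x x‖)
    (hlt : ∀ s, s < τ s → Summable fun p : β × β => ‖W s p.1 p.2 * W (τ s) p.2 p.1‖) :
    ∑' k : ι → β, ∏ s, W s (k s) (k (τ s)) =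
      (∏ s : {s // τ s = s}, ∑' x, W s x x) *
        ∏ s : {s // s < τ s}, ∑' p : β × β, W s p.1 p.2 * W (τ s) p.2 p.1 := by
  let e := involutionArrowEquiv (β := β) hτ
  have hprod (k : ι → β) : ∏ s, W s (k s) (k (τ s)) =
      (∏ s, W s.1 ((e k).1 s) ((e k).1 s)) *
        ∏ s, W s.1 ((e k).2 s).1 ((e k).2 s).2 * W (τ s.1) ((e k).2 s).2 ((e k).2 s).1 := by
    rw [prod_eq_prod_fixed_mul_prod_lt hτ fun s => W s (k s) (k (τ s))]
    simp only [hτ _]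
    refine congrArg₂ (· * ·) (Finset.prod_congr rfl fun s _ => ?_) rfl
    rw [s.2]
    rfl
  obtain ⟨hsummable, htsum⟩ := summable_norm_and_tsum_prod_apply
    (fun (s : {s // τ s = s}) x => W s x x) fun s => hfixed s s.2
  obtain ⟨hsummable', htsum'⟩ := summable_norm_and_tsum_prod_apply
    (fun (s : {s // s < τ s}) (p : β × β) => W s p.1 p.2 * W (τ s) p.2 p.1) fun s => hlt s s.2
  rw [← htsum, ← htsum', tsum_mul_tsum_of_summable_norm hsummable hsummable', ← e.tsum_eq]
  exact tsum_congr hprod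

end InvolutionOrbits

section SmallPolyBase

variable {F K : Type*} [Field F] [Fintype F] [Field K] {t : ℕ}

theorem one_lt_cast_card : (1 : ℝ) < Fintype.card F := by exact_mod_cast Fintype.one_lt_card

variable (F) in
/-- The number `q ^ d` attached to a polynomial of degree `d`, where `q` is the cardinality of `F`;
it is the square root of the cardinality of the residue field. -/
def SmallPoly.base (s : SmallPoly K t) : ℝ := (Fintype.card F : ℝ) ^ s.poly.natDegree

theorem SmallPoly.one_lt_base (s : SmallPoly K t) : 1 < s.base F :=
  one_lt_pow₀ one_lt_cast_card s.natDegree_pos.ne'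

theorem SmallPoly.base_pos (s : SmallPoly K t) : 0 < s.base F :=
  zero_lt_one.trans s.one_lt_base

theorem SmallPoly.one_lt_base_sq (s : SmallPoly K t) : 1 < s.base F ^ 2 :=
  one_lt_pow₀ s.one_lt_base two_ne_zero

variable [Algebra F K]

theorem SmallPoly.base_tilde (hK : Module.finrank F K = 2) (s : SmallPoly K t) :
    (s.tilde hK).base F = s.base F := by
  rw [SmallPoly.base, s.natDegree_tilde hK, SmallPoly.base]

theorem SmallPoly.natCard_pow_natDegree (hK : Module.finrank F K = 2) (s : SmallPoly K t) :
    (Nat.card K : ℝ) ^ s.poly.natDegree = s.base F ^ 2 := by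
  rw [natCard_eq_sq hK, SmallPoly.base, Nat.cast_pow, pow_right_comm]

end SmallPolyBase

section InclusionExclusion

variable {F K : Type*} [Field F] [Fintype F] [Field K] {t n : ℕ}

theorem mulRoot_poly_injective (k : SmallPoly K t → ℕ) :
    Function.Injective (mulRoot SmallPoly.poly k) := fun x y h => by
  ext s i
  exact mul_left_cancel₀ (root_ne_zero s.coeff_zero_ne_zero) (congrFun (congrFun h s) i)

instance [Finite (SmallPoly K t)] (k : SmallPoly K t → ℕ) :
    Module.Finite K (CyclicSum SmallPoly.poly k) := by
  have (s : SmallPoly K t) : Module.Finite K (AdjoinRoot s.poly) := s.monic.finite_adjoinRoot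
  infer_instance

variable [Fintype (SmallPoly K t)]

variable (F) in
/-- The coefficient of the multiplicities `k` in the inclusion-exclusion formula for matrices
without small factors. -/
def multiCoef (k : SmallPoly K t → ℕ) : ℝ := ∏ s, coef (s.base F ^ 2) (k s)

variable [Algebra F K]

open Classical in
theorem hasSum_multiCoef_mul_ncard (hK : Module.finrank F K = 2) {A : Matrix (Fin n) (Fin n) K}
    (hA : A.det ≠ 0) :
    HasSum (fun k : SmallPoly K t → ℕ =>
      multiCoef F k * ((equivariantEmb (mulRoot SmallPoly.poly k) (Matrix.toLin' A)).ncard : ℝ))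
      (if NoSmallFactor t A then 1 else 0) := by
  have := finite_of_finrank_eq_two hK
  let w (s : SmallPoly K t) : ℕ :=
    Module.finrank (AdjoinRoot s.poly) (kerAeval (Matrix.toLin' A) s.poly)
  let term (s : SmallPoly K t) (k : ℕ) : ℝ :=
    coef (s.base F ^ 2) k * ∏ i ∈ Finset.range k, ((s.base F ^ 2) ^ w s - (s.base F ^ 2) ^ i)
  have hterm (s : SmallPoly K t) : HasSum (term s) (if w s = 0 then 1 else 0) :=
    hasSum_coef_mul_prod s.one_lt_base_sq (w s)
  have hprod (k : SmallPoly K t → ℕ) : multiCoef F k *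
      ((equivariantEmb (mulRoot SmallPoly.poly k) (Matrix.toLin' A)).ncard : ℝ) =
        ∏ s, term s (k s) := by
    rw [ncard_equivariantEmb_mulRoot SmallPoly.pairwise_isCoprime, multiCoef,
      ← Finset.prod_mul_distrib]
    simp only [SmallPoly.natCard_pow_natDegree hK, term, w]
  obtain ⟨hsummable, htsum⟩ :=
    summable_norm_and_tsum_prod_apply term fun s => (hterm s).summable.norm
  have hvalue : ∑' k : SmallPoly K t → ℕ, ∏ s, term s (k s) =
      if NoSmallFactor t A then 1 else 0 := by
    simp only [htsum, fun s => (hterm s).tsum_eq, Finset.prod_boole, noSmallFactor_iff hA,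
      Finset.mem_univ, true_implies, w]
  simp only [hprod]
  exact hvalue ▸ hsummable.of_norm.hasSum

theorem ncard_smul_SU (g : GU F K n) :
    (g • (SU F K n : Set (GU F K n))).ncard = Nat.card (SU F K n) := by
  rw [Set.ncard_smul_set]
  rfl

open Classical in
theorem ncard_smul_SU_inter [Fintype (SU F K n)] (g : GU F K n) (P : GU F K n → Prop) :
    ({A | A ∈ g • (SU F K n : Set (GU F K n)) ∧ P A}.ncard : ℝ) =
      ∑ B : SU F K n, if P (g * B) then 1 else 0 := by
  have himage : {A | A ∈ g • (SU F K n : Set (GU F K n)) ∧ P A} =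
      (fun B : SU F K n => g * B) '' {B | P (g * B)} := by
    ext A
    simp only [Set.mem_ofPred_eq, Set.mem_smul_set, Set.mem_image, smul_eq_mul]
    constructor
    · rintro ⟨⟨B, hB, rfl⟩, hP⟩
      exact ⟨⟨B, hB⟩, hP, rfl⟩
    · rintro ⟨B, hP, rfl⟩
      exact ⟨⟨B, B.2, rfl⟩, hP⟩
  rw [himage, Set.ncard_image_of_injective _ fun B C h => Subtype.ext (mul_left_cancel h),
    Finset.sum_boole, Set.ncard_eq_toFinset_card', Set.toFinset_ofPred]

theorem proportion_smul_SU_eq_tsum [Fintype (SU F K n)] (hK : Module.finrank F K = 2)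
    (g : GU F K n) :
    proportion t (g • (SU F K n : Set (GU F K n))) =
      ∑' k : SmallPoly K t → ℕ, multiCoef F k *
        ((∑ B : SU F K n, (equivariantEmb (mulRoot SmallPoly.poly k)
          (Matrix.toLin' (g * B.1).1.1)).ncard : ℕ) / Nat.card (SU F K n) : ℝ) := by
  classical
  have hindicator (B : SU F K n) := hasSum_multiCoef_mul_ncard (t := t) hK
    (Matrix.GeneralLinearGroup.det_ne_zero (g * B.1).1)
  rw [proportion, ncard_smul_SU_inter, ncard_smul_SU,
    ← (hasSum_sum fun B _ => hindicator B).tsum_eq, ← tsum_div_const]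
  refine tsum_congr fun k => ?_
  rw [← Finset.mul_sum, Nat.cast_sum, mul_div_assoc]

end InclusionExclusion

section Limit

variable {F K : Type*} [Field F] [Fintype F] [Field K] {t : ℕ} [Fintype (SmallPoly K t)]

theorem prod_base_pow_nonneg (e : SmallPoly K t → ℕ) : 0 ≤ ∏ s, s.base F ^ e s :=
  Finset.prod_nonneg fun s _ => (pow_pos s.base_pos _).le

variable [Algebra F K]

theorem ncard_invariantHermitianForms_smallPoly (hK : Module.finrank F K = 2)
    (k : SmallPoly K t → ℕ) :
    ((invariantHermitianForms (conj F K) (mulRoot SmallPoly.poly k)).ncard : ℝ) =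
      ∏ s, s.base F ^ (k s * k (s.tilde hK)) := by
  classical
  rw [ncard_invariantHermitianForms_mulRoot hK SmallPoly.coeff_zero_ne_zero SmallPoly.monic
    (fun _ _ => SmallPoly.ext) (τ := SmallPoly.tilde hK) fun _ => rfl, Nat.cast_prod]
  refine Finset.prod_congr rfl fun s _ => ?_
  rw [s.natDegree_tilde, SmallPoly.base, Nat.cast_pow, ← pow_mul, mul_assoc]

theorem prod_base_pow_mul_tilde_le (hK : Module.finrank F K = 2) (k : SmallPoly K t → ℕ) :
    ∏ s, s.base F ^ (k s * k (s.tilde hK)) ≤ ∏ s, s.base F ^ (k s ^ 2) := by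
  have prod_tilde : ∏ s : SmallPoly K t, s.base F ^ (k (s.tilde hK) ^ 2) =
      ∏ s, s.base F ^ (k s ^ 2) :=
    Fintype.prod_equiv (SmallPoly.tilde_involutive hK).toPerm _ _ fun s => by
      rw [Function.Involutive.coe_toPerm, s.base_tilde]
  refine (pow_le_pow_iff_left₀ (prod_base_pow_nonneg _) (prod_base_pow_nonneg _) two_ne_zero).1 ?_
  calc (∏ s, s.base F ^ (k s * k (s.tilde hK))) ^ 2
      = ∏ s, s.base F ^ (2 * k s * k (s.tilde hK)) := by
        rw [← Finset.prod_pow]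
        exact Finset.prod_congr rfl fun s _ => by ring
    _ ≤ ∏ s, s.base F ^ (k s ^ 2 + k (s.tilde hK) ^ 2) :=
        Finset.prod_le_prod (fun s _ => (pow_pos s.base_pos _).le) fun s _ =>
          pow_le_pow_right₀ s.one_lt_base.le (two_mul_le_add_sq _ _)
    _ = (∏ s, s.base F ^ (k s ^ 2)) ^ 2 := by
        simp only [pow_add, Finset.prod_mul_distrib]
        rw [prod_tilde, pow_two]

theorem summable_norm_multiCoef_mul (hK : Module.finrank F K = 2) :
    Summable fun k : SmallPoly K t → ℕ =>
      ‖multiCoef F k‖ * ∏ s, s.base F ^ (k s * k (s.tilde hK)) := by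
  have summable_selfCoef_prod := (summable_norm_and_tsum_prod_apply
    (fun (s : SmallPoly K t) k => selfCoef (s.base F) k)
    fun s => summable_selfCoef s.one_lt_base).1
  refine summable_selfCoef_prod.of_nonneg_of_le
    (fun k => mul_nonneg (norm_nonneg _) (prod_base_pow_nonneg _)) fun k => ?_
  simp only [selfCoef, Finset.prod_mul_distrib, norm_mul,
    Real.norm_of_nonneg (prod_base_pow_nonneg _)]
  exact mul_le_mul_of_nonneg_left (prod_base_pow_mul_tilde_le hK k) (norm_nonneg _)

theorem tendsto_proportion_tsum (hK : Module.finrank F K = 2) (g : (n : ℕ) → GU F K n) :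
    Tendsto (fun n : ℕ => proportion t (g n • (SU F K n : Set (GU F K n)))) atTop
      (𝓝 (∑' k : SmallPoly K t → ℕ,
        multiCoef F k * ∏ s, s.base F ^ (k s * k (s.tilde hK)))) := by
  have := finite_of_finrank_eq_two hK
  have (n : ℕ) := Fintype.ofFinite (SU F K n)
  have card_SU_pos (n : ℕ) : (0 : ℝ) < Nat.card (SU F K n) := by exact_mod_cast Nat.card_pos
  simp only [proportion_smul_SU_eq_tsum hK, ← ncard_invariantHermitianForms_smallPoly hK]
  refine tendsto_tsum_of_dominated_convergence
    ((summable_norm_multiCoef_mul (t := t) hK).mul_right (Nat.card Kˣ : ℝ)) (fun k => ?_)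
    (Eventually.of_forall fun n k => ?_)
  · refine tendsto_const_nhds.congr' ?_
    filter_upwards [eventually_gt_atTop (2 * Module.finrank K (CyclicSum SmallPoly.poly k))]
      with n hn
    rw [sum_SU_ncard_equivariantEmb hK hn (mulRoot_poly_injective k), Nat.cast_mul,
      mul_div_cancel_right₀ _ (card_SU_pos n).ne']
  · rw [norm_mul, mul_assoc, ← ncard_invariantHermitianForms_smallPoly hK]
    refine mul_le_mul_of_nonneg_left ?_ (norm_nonneg _)
    rw [Real.norm_of_nonneg (by positivity), div_le_iff₀ (card_SU_pos n), mul_assoc]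
    exact_mod_cast sum_SU_ncard_equivariantEmb_le hK (mulRoot_poly_injective k) (g n)

end Limit

section Evaluation

theorem summable_norm_pair {b : ℝ} (hb : 1 < b) :
    Summable fun p : ℕ × ℕ => ‖coef (b ^ 2) p.1 * b ^ (p.1 * p.2) *
      (coef (b ^ 2) p.2 * b ^ (p.2 * p.1))‖ := by
  have hb0 : 0 < b := zero_lt_one.trans hb
  refine ((summable_selfCoef hb).mul_norm (summable_selfCoef hb)).of_nonneg_of_le
    (fun _ => norm_nonneg _) fun p => ?_
  have pow_le : b ^ (2 * p.1 * p.2) ≤ b ^ (p.1 ^ 2 + p.2 ^ 2) :=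
    pow_le_pow_right₀ hb.le (two_mul_le_add_sq _ _)
  simp only [selfCoef, norm_mul, norm_pow, Real.norm_of_nonneg hb0.le]
  calc ‖coef (b ^ 2) p.1‖ * b ^ (p.1 * p.2) * (‖coef (b ^ 2) p.2‖ * b ^ (p.2 * p.1))
      = ‖coef (b ^ 2) p.1‖ * ‖coef (b ^ 2) p.2‖ * b ^ (2 * p.1 * p.2) := by ring
    _ ≤ ‖coef (b ^ 2) p.1‖ * ‖coef (b ^ 2) p.2‖ * b ^ (p.1 ^ 2 + p.2 ^ 2) := by gcongr
    _ = ‖coef (b ^ 2) p.1‖ * b ^ (p.1 ^ 2) * (‖coef (b ^ 2) p.2‖ * b ^ (p.2 ^ 2)) := by ring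

theorem tsum_pair {b : ℝ} (hb : 1 < b) :
    ∑' p : ℕ × ℕ, coef (b ^ 2) p.1 * b ^ (p.1 * p.2) * (coef (b ^ 2) p.2 * b ^ (p.2 * p.1)) =
      ∏' i : ℕ, (1 - (b ^ 2)⁻¹ ^ (i + 1)) := by
  have hb2 : 1 < b ^ 2 := one_lt_pow₀ hb two_ne_zero
  have inner_sum (n : ℕ) :
      ∑' m, coef (b ^ 2) n * b ^ (n * m) * (coef (b ^ 2) m * b ^ (m * n)) =
        coef (b ^ 2) n * ∑' m, coef (b ^ 2) m * ((b ^ 2) ^ n) ^ m := by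
    rw [← tsum_mul_left]
    exact tsum_congr fun m => by ring
  have inner_sum_eq_zero (n : ℕ) (hn : n ≠ 0) :
      coef (b ^ 2) n * ∑' m, coef (b ^ 2) m * ((b ^ 2) ^ n) ^ m = 0 := by
    obtain ⟨m, rfl⟩ := Nat.exists_eq_succ_of_ne_zero hn
    rw [Nat.succ_eq_add_one, tsum_coef_mul_pow_pow_succ hb2, mul_zero]
  rw [(summable_norm_pair hb).of_norm.tsum_prod, tsum_congr inner_sum,
    tsum_eq_single 0 inner_sum_eq_zero, ← tsum_coef hb2]
  simp only [coef_zero, pow_zero, one_pow, mul_one, one_mul]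

variable {F K : Type*} [Field F] [Fintype F] [Field K] [Algebra F K] {t : ℕ}
  [Fintype (SmallPoly K t)]

theorem tsum_multiCoef_mul_eq (hK : Module.finrank F K = 2) [LinearOrder (SmallPoly K t)] :
    ∑' k : SmallPoly K t → ℕ, multiCoef F k * ∏ s, s.base F ^ (k s * k (s.tilde hK)) =
      (∏ s : {s : SmallPoly K t // s.tilde hK = s}, ∏' i : ℕ, (1 + (-(s.1.base F)⁻¹) ^ (i + 1))) *
      ∏ s : {s : SmallPoly K t // s < s.tilde hK},
        ∏' i : ℕ, (1 - (s.1.base F ^ 2)⁻¹ ^ (i + 1)) := by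
  have orbits := tsum_prod_involution (SmallPoly.tilde_involutive (t := t) hK)
    (fun s n m => coef (s.base F ^ 2) n * s.base F ^ (n * m))
    (fun s _ => (summable_selfCoef s.one_lt_base).congr fun n => by rw [selfCoef, pow_two n])
    (fun s _ => by
      simpa only [s.base_tilde hK] using summable_norm_pair s.one_lt_base)
  simp only [SmallPoly.base_tilde, tsum_pair (SmallPoly.one_lt_base _), ← pow_two] at orbits
  simp only [multiCoef, ← Finset.prod_mul_distrib, orbits]
  exact congrArg (· * _) (Finset.prod_congr rfl fun s _ => tsum_selfCoef s.1.one_lt_base)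

end Evaluation

section DegreeProducts

theorem one_div_neg_pow_mul (q : ℝ) (i j : ℕ) :
    1 / (-q) ^ ((i + 1) * j) = ((-q) ^ j)⁻¹ ^ (i + 1) := by
  rw [one_div, inv_pow, ← pow_mul, mul_comm]

theorem one_div_pow_two_mul (q : ℝ) (i j : ℕ) :
    1 / q ^ (2 * (i + 1) * j) = ((q ^ j) ^ 2)⁻¹ ^ (i + 1) := by
  rw [one_div, inv_pow]
  ring

theorem multipliable_one_add_one_div_neg_pow {q : ℝ} (hq : 1 < q) {j : ℕ} (hj : 1 ≤ j) :
    Multipliable fun i : ℕ => 1 + 1 / (-q) ^ ((i + 1) * j) := by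
  simp only [one_div_neg_pow_mul]
  refine multipliable_one_add_pow_succ ?_
  rw [abs_inv, abs_pow, abs_neg, abs_of_pos (zero_lt_one.trans hq)]
  exact inv_lt_one_of_one_lt₀ (one_lt_pow₀ hq (Nat.one_le_iff_ne_zero.1 hj))

theorem multipliable_one_sub_one_div_pow {q : ℝ} (hq : 1 < q) {j : ℕ} (hj : 1 ≤ j) :
    Multipliable fun i : ℕ => 1 - 1 / q ^ (2 * (i + 1) * j) := by
  simp only [one_div_pow_two_mul]
  exact multipliable_one_sub_pow_succ
    (abs_inv_lt_one (one_lt_pow₀ (one_lt_pow₀ hq (Nat.one_le_iff_ne_zero.1 hj)) two_ne_zero))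

variable {F K : Type*} [Field F] [Fintype F] [Field K] [Algebra F K] {t : ℕ}

theorem natCard_tilde_eq_self (hK : Module.finrank F K = 2) {j : ℕ} (hj : j ≤ t) :
    Nat.card {s : {s : SmallPoly K t // s.tilde hK = s} // s.1.poly.natDegree = j} =
      tildeN F K j :=
  Nat.card_congr
    { toFun s := ⟨s.1.1.poly, s.1.1.monic, s.1.1.irreducible, s.2, s.1.1.coeff_zero_ne_zero,
        (congrArg SmallPoly.poly s.1.2).symm⟩
      invFun f := ⟨⟨⟨f.1, f.2.1, f.2.2.1, f.2.2.2.1.trans_le hj, f.2.2.2.2.1⟩,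
        SmallPoly.ext f.2.2.2.2.2.symm⟩, f.2.2.2.1⟩
      left_inv _ := rfl
      right_inv _ := rfl }

theorem natCard_lt_tilde (hK : Module.finrank F K = 2) [LinearOrder (SmallPoly K t)] {j : ℕ}
    (hj : j ≤ t) :
    Nat.card {s : {s : SmallPoly K t // s < s.tilde hK} // s.1.poly.natDegree = j} =
      tildeM F K j := by
  refine Nat.card_congr (Equiv.ofBijective
    (fun s => ⟨s(s.1.1.poly, (s.1.1.tilde hK).poly), s.1.1.poly, s.1.1.monic, s.1.1.irreducible,
      s.2, s.1.1.coeff_zero_ne_zero, fun h => s.1.2.ne (SmallPoly.ext h), rfl⟩) ⟨?_, ?_⟩)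
  · rintro ⟨⟨a, ha⟩, _⟩ ⟨⟨b, hb⟩, _⟩ hab
    rcases Sym2.eq_iff.1 (congrArg Subtype.val hab) with ⟨hpoly, -⟩ | ⟨hpoly, hpoly'⟩
    · obtain rfl : a = b := SmallPoly.ext hpoly
      rfl
    · obtain rfl : a = b.tilde hK := SmallPoly.ext hpoly
      rw [show (b.tilde hK).tilde hK = b from SmallPoly.ext hpoly'] at ha
      exact absurd ha hb.not_gt
  · rintro ⟨_, f, monic, irreducible, natDegree_eq, coeff_ne_zero, hne, rfl⟩
    let s : SmallPoly K t := ⟨f, monic, irreducible, natDegree_eq.trans_le hj, coeff_ne_zero⟩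
    rcases lt_trichotomy s (s.tilde hK) with hlt | heq | hgt
    · exact ⟨⟨⟨s, hlt⟩, natDegree_eq⟩, rfl⟩
    · exact absurd (congrArg SmallPoly.poly heq) hne
    · refine ⟨⟨⟨s.tilde hK, by rwa [SmallPoly.tilde_involutive hK s]⟩,
        (s.natDegree_tilde hK).trans natDegree_eq⟩, Subtype.ext ?_⟩
      dsimp only
      rw [SmallPoly.tilde_involutive hK s]
      exact Sym2.eq_swap

theorem prod_apply_eq_prod_pow_natCard {α β M : Type*} [Fintype α] [CommMonoid M]
    {d : α → β} {S : Finset β} (u : β → M) (hd : ∀ a, d a ∈ S) :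
    ∏ a, u (d a) = ∏ b ∈ S, u b ^ Nat.card {a // d a = b} := by
  classical
  rw [← Finset.prod_fiberwise_of_maps_to' fun a _ => hd a]
  refine Finset.prod_congr rfl fun j _ => ?_
  rw [Finset.prod_const, Nat.card_eq_fintype_card, Fintype.card_subtype]

theorem SmallPoly.natDegree_mem_Icc (s : SmallPoly K t) : s.poly.natDegree ∈ Finset.Icc 1 t :=
  Finset.mem_Icc.2 ⟨s.natDegree_pos, s.natDegree_le⟩

variable [Fintype (SmallPoly K t)]

theorem prod_tilde_eq_self (hK : Module.finrank F K = 2) [DecidableEq (SmallPoly K t)] :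
    ∏ s : {s : SmallPoly K t // s.tilde hK = s}, ∏' i : ℕ, (1 + (-(s.1.base F)⁻¹) ^ (i + 1)) =
      ∏ j ∈ Finset.Icc 1 t,
        ∏' i : ℕ, (1 + 1 / (-(Fintype.card F : ℝ)) ^ ((i + 1) * j)) ^ tildeN F K j := by
  let u (j : ℕ) : ℝ := ∏' i : ℕ, (1 + 1 / (-(Fintype.card F : ℝ)) ^ ((i + 1) * j))
  have factor_eq (s : {s : SmallPoly K t // s.tilde hK = s}) :
      ∏' i : ℕ, (1 + (-(s.1.base F)⁻¹) ^ (i + 1)) = u s.1.poly.natDegree := by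
    have hodd : Odd s.1.poly.natDegree :=
      odd_natDegree_of_eq_tildeConj hK s.1.coeff_zero_ne_zero s.1.irreducible
        (congrArg SmallPoly.poly s.2).symm
    simp only [u, one_div_neg_pow_mul, hodd.neg_pow, SmallPoly.base, inv_neg]
  simp only [factor_eq]
  rw [prod_apply_eq_prod_pow_natCard u fun s => s.1.natDegree_mem_Icc]
  refine Finset.prod_congr rfl fun j hj => ?_
  obtain ⟨one_le, le_t⟩ := Finset.mem_Icc.1 hj
  rw [natCard_tilde_eq_self hK le_t,
    (multipliable_one_add_one_div_neg_pow one_lt_cast_card one_le).tprod_pow]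

theorem prod_lt_tilde (hK : Module.finrank F K = 2) [LinearOrder (SmallPoly K t)] :
    ∏ s : {s : SmallPoly K t // s < s.tilde hK}, ∏' i : ℕ, (1 - (s.1.base F ^ 2)⁻¹ ^ (i + 1)) =
      ∏ j ∈ Finset.Icc 1 t,
        ∏' i : ℕ, (1 - 1 / (Fintype.card F : ℝ) ^ (2 * (i + 1) * j)) ^ tildeM F K j := by
  let u (j : ℕ) : ℝ := ∏' i : ℕ, (1 - 1 / (Fintype.card F : ℝ) ^ (2 * (i + 1) * j))
  have factor_eq (s : {s : SmallPoly K t // s < s.tilde hK}) :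
      ∏' i : ℕ, (1 - (s.1.base F ^ 2)⁻¹ ^ (i + 1)) = u s.1.poly.natDegree := by
    simp only [u, one_div_pow_two_mul, SmallPoly.base]
  simp only [factor_eq]
  rw [prod_apply_eq_prod_pow_natCard u fun s => s.1.natDegree_mem_Icc]
  refine Finset.prod_congr rfl fun j hj => ?_
  obtain ⟨one_le, le_t⟩ := Finset.mem_Icc.1 hj
  rw [natCard_lt_tilde hK le_t,
    (multipliable_one_sub_one_div_pow one_lt_cast_card one_le).tprod_pow]

end DegreeProducts

end UnitaryCoset

end

theorem mainTheorem6 {F K : Type*} [Field F] [Fintype F] [Field K] [Algebra F K]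
    (hK : Module.finrank F K = 2) (q : ℕ) (hq : Fintype.card F = q) (t : ℕ) :
    (∀ j : ℕ, 1 ≤ j →
      Multipliable (fun i : ℕ =>
        (1 + 1 / (-(q : ℝ)) ^ ((i + 1) * j)) ^ UnitaryCoset.tildeN F K j) ∧
      Multipliable (fun i : ℕ =>
        (1 - 1 / (q : ℝ) ^ (2 * (i + 1) * j)) ^ UnitaryCoset.tildeM F K j)) ∧
    ∀ g : (n : ℕ) → UnitaryCoset.GU F K n,
      Tendsto
        (fun n : ℕ => UnitaryCoset.proportion t
          (g n • (UnitaryCoset.SU F K n : Set (UnitaryCoset.GU F K n))))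
        atTop
        (𝓝 (∏ j ∈ Finset.Icc 1 t,
          ((∏' i : ℕ, (1 + 1 / (-(q : ℝ)) ^ ((i + 1) * j)) ^ UnitaryCoset.tildeN F K j) *
            ∏' i : ℕ, (1 - 1 / (q : ℝ) ^ (2 * (i + 1) * j)) ^ UnitaryCoset.tildeM F K j))) := by
  classical
  subst hq
  refine ⟨fun j hj =>
    ⟨(UnitaryCoset.multipliable_one_add_one_div_neg_pow UnitaryCoset.one_lt_cast_card hj).pow _,
    (UnitaryCoset.multipliable_one_sub_one_div_pow UnitaryCoset.one_lt_cast_card hj).pow _⟩,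
    fun g => ?_⟩
  have := UnitaryCoset.finite_of_finrank_eq_two hK
  have := UnitaryCoset.finite_smallPoly (K := K) (t := t)
  have := Fintype.ofFinite (UnitaryCoset.SmallPoly K t)
  let _ : LinearOrder (UnitaryCoset.SmallPoly K t) :=
    LinearOrder.lift' (Fintype.equivFin _) (Fintype.equivFin _).injective
  have limit := UnitaryCoset.tendsto_proportion_tsum (t := t) hK g
  rwa [UnitaryCoset.tsum_multiCoef_mul_eq hK, UnitaryCoset.prod_tilde_eq_self hK,
    UnitaryCoset.prod_lt_tilde hK, ← Finset.prod_mul_distrib] at limit
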